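/- A complex Hadamard matrix of order $n$ is a unitary $n\times n$ matrix all of whose entries have modulus $1/\sqrt n$. Two such matrices $H,K$ are equivalent if $H=D_1P_1KP_2D_2$ with $D_1,D_2$ diagonal matrices of phases and $P_1,P_2$ permutation matrices. Dephasing $H$ means multiplying its rows and columns by phases so that all entries of the first row and column become $1/\sqrt n$. $H\in BH(n,r)$ means that $H$ is a complex Hadamard matrix and all entries of $\sqrt n\,H$ are $r$-th roots of unity. The defect of $H$ is the dimension of the real space of real $n\times n$ matrices $R$ with zero first row and column that satisfy $\sum_k H_{ik}\overline{H_{jk}}(R_{ik}-R_{jk})=0$ for all $i,j$. An affine family stemming from $H$ is a set $\{H\circ \mathrm{EXP}(iR): R\in\mathcal R\}$ of complex Hadamard matrices, where $\mathcal R$ is a linear space of real matrices with zero first row and column, and $\circ$, $\mathrm{EXP}$ are the entrywise product and exponential. A Diţă-type matrix of order $kv$, $k,v>1$, is a block matrix with blocks $m_{ij}N_j$ ($1\le i,j\le k$), where $M=(m_{ij})$ and $N_1,\dots,N_k$ are complex Hadamard matrices of orders $k$ and $v$. Let $\omega=e^{2\pi i/7}$, let $F_n=\frac1{\sqrt n}(e^{2\pi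 i jk/n})_{0\le j,k<n}$, $D=\mathrm{diag}(1,1,\omega,\omega^3,\omega^6,\omega^3,\omega)$ and $H_j=D^jF_7$. Let $S_{14}=\frac1{\sqrt{14}}(\omega^{e_{ij}})$ with exponent matrix $$(e_{ij})=\begin{pmatrix} 0&0&0&0&0&0&0&0&0&0&0&0&0&0\\ 0&1&2&3&4&5&6&0&1&2&3&4&5&6\\ 0&2&4&6&1&3&5&2&4&6&1&3&5&0\\ 0&3&6&2&5&1&4&6&2&5&1&4&0&3\\ 0&4&1&5&2&6&3&5&2&6&3&0&4&1\\ 0&5&3&1&6&4&2&6&4&2&0&5&3&1\\ 0&6&5&4&3&2&1&2&1&0&6&5&4&3\\ 0&1&3&6&3&1&0&5&5&4&2&6&2&4\\ 0&0&1&3&6&3&1&4&5&5&4&2&6&2\\ 0&6&6&0&2&5&2&1&3&4&4&3&1&5\\ 0&5&4&4&5&0&3&3&6&1&2&2&1&6\\ 0&4&2&1&1&2&4&3&0&3&5&6&6&5\\ 0&3&0&5&4&4&5&1&6&3&6&1&2&2\\ 0&2&5&2&0&6&6&4&3&1&5&1&3&4 \end{pmatrix}.$$ Proposition. The bases $I_7,F_7,H_1,\dots,H_6$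 form a complete set of mutually unbiased bases of $\mathbb C^7$. With $K_1=H_1$ and $L_1=H_2$, the block matrix $$\frac1{\sqrt2}\begin{pmatrix}F_7&L_1\\K_1^\dagger F_7&-K_1^\dagger L_1\end{pmatrix}$$ is a complex Hadamard matrix whose dephased form is $S_{14}$, and $S_{14}\in BH(14,7)$. The matrix $S_{14}$ is isolated: its defect is $0$, and every complex Hadamard matrix in some neighbourhood of $S_{14}$ is equivalent to $S_{14}$. Moreover, $S_{14}$ is inequivalent to each of the following: 1. every member of the six-parameter Fourier family $F_{14}^{(6)}(a)=F_{14}\circ\mathrm{EXP}(iR(a))$, $a\in\mathbb R^6$, where, with rows counted from $0$, the odd rows of $R(a)$ are $(0,a_1,\dots,a_6,0,a_1,\dots,a_6)$ and the even rows are zero; and the transpose of every member; 2. every member of every affine family stemming from a matrix $D_{14}$, i.e. from the dephased form of $\frac1{\sqrt{14}}(I+iC)$ with $C$ a real symmetric conference matrix of order $14$ (zero diagonal, off-diagonal entries $\pm1$, $CC^T=13I$); in particular every member of $D_{14}^{(5)}$; 3. every matrix in $BH(14,r)$ with $7\nmid r$; in particular (with $r=4$) all the isolated quaternary matrices $L_{14X}^{(0)}$,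 $X=A,\dots,N$; 4. every Diţă-type matrix of order $14$; 5. every member of every affine family of positive dimension of complex Hadamard matrices of order $14$. -/

import Mathlib

open scoped Matrix

noncomputable section

namespace CHM

/-- Complex Hadamard matrix of order `n`: a unitary matrix all of whose entries have the
same modulus (which is then `1/√n`). -/
def IsHadamard {n : ℕ} (H : Matrix (Fin n) (Fin n) ℂ) : Prop :=
  H * Hᴴ = 1 ∧ ∀ i j, ‖H i j‖ = 1 / √(n : ℝ)

/-- `H = D₁ P₁ K P₂ D₂` with `D₁, D₂` diagonal matrices of phases and `P₁, P₂` permutation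
matrices. -/
def Equivalent {n : ℕ} (H K : Matrix (Fin n) (Fin n) ℂ) : Prop :=
  ∃ (d₁ d₂ : Fin n → ℂ) (σ τ : Equiv.Perm (Fin n)),
    (∀ i, ‖d₁ i‖ = 1) ∧ (∀ i, ‖d₂ i‖ = 1) ∧
    H = Matrix.diagonal d₁ * σ.permMatrix ℂ * K * τ.permMatrix ℂ * Matrix.diagonal d₂

/-- The dephased form: rows and columns are multiplied by phases so that the first row and the
first column are constant equal to `1/√n`. -/
def dephase {n : ℕ} [NeZero n] (H : Matrix (Fin n) (Fin n) ℂ) : Matrix (Fin n) (Fin n) ℂ :=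
  Matrix.of fun i j => (H i j * H 0 0) / (H i 0 * H 0 j) / (√(n : ℝ) : ℂ)

/-- Butson–Hadamard matrix of class `BH(n, r)`. -/
def IsButson (n r : ℕ) (H : Matrix (Fin n) (Fin n) ℂ) : Prop :=
  IsHadamard H ∧ ∀ i j, ∃ ζ : ℂ, ζ ^ r = 1 ∧ H i j = ζ / (√(n : ℝ) : ℂ)

/-- Two unitary matrices represent mutually unbiased bases (given by their columns). -/
def IsMU {d : ℕ} (U V : Matrix (Fin d) (Fin d) ℂ) : Prop :=
  ∀ i j, ‖(Uᴴ * V) i j‖ ^ 2 = 1 / (d : ℝ)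

/-- A complete set of `d + 1` mutually unbiased orthonormal bases of `ℂ^d`. -/
def IsCompleteMUSet {d : ℕ} {ι : Type*} [Fintype ι]
    (B : ι → Matrix (Fin d) (Fin d) ℂ) : Prop :=
  Fintype.card ι = d + 1 ∧ (∀ i, B i ∈ Matrix.unitaryGroup (Fin d) ℂ) ∧
    ∀ i j, i ≠ j → IsMU (B i) (B j)

/-- Real matrices whose first row and first column vanish. -/
def zeroBorder (n : ℕ) [NeZero n] : Submodule ℝ (Matrix (Fin n) (Fin n) ℝ) where
  carrier := {R | (∀ j, R 0 j = 0) ∧ ∀ i, R i 0 = 0}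
  add_mem' := by
    rintro A B ⟨a, b⟩ ⟨c, d⟩
    exact ⟨fun j => by simp [a j, c j], fun i => by simp [b i, d i]⟩
  zero_mem' := ⟨fun _ => rfl, fun _ => rfl⟩
  smul_mem' := by
    rintro c A ⟨a, b⟩
    exact ⟨fun j => by simp [a j], fun i => by simp [b i]⟩

/-- The entrywise product `H ∘ EXP(i R)`. -/
def twist {n : ℕ} (H : Matrix (Fin n) (Fin n) ℂ) (R : Matrix (Fin n) (Fin n) ℝ) :
    Matrix (Fin n) (Fin n) ℂ :=
  Matrix.of fun i j => H i j * Complex.exp (Complex.I * (R i j : ℂ))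

/-- Solutions, with vanishing first row and column, of the unitarity conditions for
`H ∘ EXP(i R)` to first order in `R`. -/
def tangentSpace {n : ℕ} [NeZero n] (H : Matrix (Fin n) (Fin n) ℂ) :
    Submodule ℝ (Matrix (Fin n) (Fin n) ℝ) where
  carrier := {R | R ∈ zeroBorder n ∧
    ∀ i j, ∑ k, H i k * star (H j k) * ((R i k : ℂ) - (R j k : ℂ)) = 0}
  add_mem' := by
    rintro A B ⟨a, b⟩ ⟨c, d⟩
    refine ⟨add_mem a c, fun i j => ?_⟩
    rw [← add_zero (0 : ℂ)]
    nth_rewrite 1 [← b i j]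
    rw [← d i j, ← Finset.sum_add_distrib]
    refine Finset.sum_congr rfl fun k _ => ?_
    simp only [Matrix.add_apply, Complex.ofReal_add]
    ring
  zero_mem' := ⟨zero_mem _, fun i j => by simp⟩
  smul_mem' := by
    rintro c A ⟨a, b⟩
    refine ⟨Submodule.smul_mem _ c a, fun i j => ?_⟩
    rw [← mul_zero (c : ℂ), ← b i j, Finset.mul_sum]
    refine Finset.sum_congr rfl fun k _ => ?_
    simp only [Matrix.smul_apply, smul_eq_mul, Complex.ofReal_mul]
    ring

/-- The defect of `H`. -/
def defect {n : ℕ} [NeZero n] (H : Matrix (Fin n) (Fin n) ℂ) : ℕ :=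
  Module.finrank ℝ (tangentSpace H)

/-- `{H ∘ EXP(i R) : R ∈ 𝓡}` is an affine family of Hadamard matrices stemming from `H`. -/
def IsAffineFamily {n : ℕ} [NeZero n] (H : Matrix (Fin n) (Fin n) ℂ)
    (𝓡 : Submodule ℝ (Matrix (Fin n) (Fin n) ℝ)) : Prop :=
  𝓡 ≤ zeroBorder n ∧ ∀ R ∈ 𝓡, IsHadamard (twist H R)

/-- Diţă-type matrices of order `n = k v`, with `k, v > 1`: the `(i, j)` block is `m_{ij} N_j`.
The matrices `M`, `N_j` are not required to be dephased, so that the free phases of the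
construction are included. -/
def IsDitaType {n : ℕ} (Q : Matrix (Fin n) (Fin n) ℂ) : Prop :=
  ∃ (k v : ℕ) (h : k * v = n) (M : Matrix (Fin k) (Fin k) ℂ)
    (N : Fin k → Matrix (Fin v) (Fin v) ℂ),
    1 < k ∧ 1 < v ∧ IsHadamard M ∧ (∀ j, IsHadamard (N j)) ∧
    Q = Matrix.reindex (finProdFinEquiv.trans (finCongr h)) (finProdFinEquiv.trans (finCongr h))
      (Matrix.of fun (x y : Fin k × Fin v) => M x.1 y.1 * N y.1 x.2 y.2)

/-- The Fourier matrix of order `n`. -/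
def fourier (n : ℕ) : Matrix (Fin n) (Fin n) ℂ :=
  Matrix.of fun i j =>
    Complex.exp (2 * Real.pi * Complex.I / n) ^ ((i : ℕ) * (j : ℕ)) / (√(n : ℝ) : ℂ)

/-- The six-parameter Fourier family `F₁₄⁽⁶⁾(a)`: the phases `(0, a₁, …, a₆, 0, a₁, …, a₆)` are
attached to every second row of `F₁₄`. -/
def fourierFamily14 (a : Fin 6 → ℝ) : Matrix (Fin 14) (Fin 14) ℂ :=
  twist (fourier 14) (Matrix.of fun i j =>
    if (i : ℕ) % 2 = 1 then (Fin.cons 0 a : Fin 7 → ℝ) (Fin.ofNat 7 j) else 0)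

/-- Real symmetric conference matrices of order `n`. -/
def IsSymmConference {n : ℕ} (C : Matrix (Fin n) (Fin n) ℝ) : Prop :=
  C.IsSymm ∧ (∀ i, C i i = 0) ∧ (∀ i j, i ≠ j → C i j = 1 ∨ C i j = -1) ∧
    C * Cᵀ = ((n : ℝ) - 1) • (1 : Matrix (Fin n) (Fin n) ℝ)

/-- The dephased form of `(I + i C)/√n`; for a symmetric conference matrix `C` of order 14 this
is the matrix `D₁₄`. -/
def conferenceHadamard {n : ℕ} [NeZero n] (C : Matrix (Fin n) (Fin n) ℝ) :
    Matrix (Fin n) (Fin n) ℂ :=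
  dephase ((1 / (√(n : ℝ) : ℂ)) • (1 + Complex.I • C.map Complex.ofReal))

/-- `ω = exp(2πi/7)`. -/
def ω : ℂ := Complex.exp (2 * Real.pi * Complex.I / 7)

/-- `D = diag(1, 1, ω, ω³, ω⁶, ω³, ω)`. -/
def D7 : Matrix (Fin 7) (Fin 7) ℂ :=
  Matrix.diagonal ![1, 1, ω, ω ^ 3, ω ^ 6, ω ^ 3, ω]

/-- `H_j = D^j F₇` (so `H_0 = F₇`). -/
def H7 (j : ℕ) : Matrix (Fin 7) (Fin 7) ℂ := D7 ^ j * fourier 7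

/-- The eight bases `I₇, F₇, H₁, …, H₆`. -/
def bases7 : Option (Fin 7) → Matrix (Fin 7) (Fin 7) ℂ
  | none => 1
  | some j => H7 j

/-- The block matrix with blocks `F₇, L, K†F₇, -K†L`, divided by `√2`. -/
def H14 (K L : Matrix (Fin 7) (Fin 7) ℂ) : Matrix (Fin 14) (Fin 14) ℂ :=
  (1 / (√(2 : ℝ) : ℂ)) •
    Matrix.reindex (finSumFinEquiv (m := 7) (n := 7)) (finSumFinEquiv (m := 7) (n := 7))
      (Matrix.fromBlocks (fourier 7) L (Kᴴ * fourier 7) (-(Kᴴ * L)))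

/-- Exponents of `ω` in `S₁₄`. -/
def expS14 : Matrix (Fin 14) (Fin 14) ℕ :=
  !![0, 0, 0, 0, 0, 0, 0, 0, 0, 0, 0, 0, 0, 0;
    0, 1, 2, 3, 4, 5, 6, 0, 1, 2, 3, 4, 5, 6;
    0, 2, 4, 6, 1, 3, 5, 2, 4, 6, 1, 3, 5, 0;
    0, 3, 6, 2, 5, 1, 4, 6, 2, 5, 1, 4, 0, 3;
    0, 4, 1, 5, 2, 6, 3, 5, 2, 6, 3, 0, 4, 1;
    0, 5, 3, 1, 6, 4, 2, 6, 4, 2, 0, 5, 3, 1;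
    0, 6, 5, 4, 3, 2, 1, 2, 1, 0, 6, 5, 4, 3;
    0, 1, 3, 6, 3, 1, 0, 5, 5, 4, 2, 6, 2, 4;
    0, 0, 1, 3, 6, 3, 1, 4, 5, 5, 4, 2, 6, 2;
    0, 6, 6, 0, 2, 5, 2, 1, 3, 4, 4, 3, 1, 5;
    0, 5, 4, 4, 5, 0, 3, 3, 6, 1, 2, 2, 1, 6;
    0, 4, 2, 1, 1, 2, 4, 3, 0, 3, 5, 6, 6, 5;
    0, 3, 0, 5, 4, 4, 5, 1, 6, 3, 6, 1, 2, 2;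
    0, 2, 5, 2, 0, 6, 6, 4, 3, 1, 5, 1, 3, 4]

/-- The matrix `S₁₄`. -/
def S14 : Matrix (Fin 14) (Fin 14) ℂ :=
  Matrix.of fun i j => ω ^ expS14 i j / (√(14 : ℝ) : ℂ)

end CHM

end

/-! Split into four 7 × 7 blocks, the exponents of `S14` are quadratic polynomials over `ZMod 7`, so
everything reduces to Fourier analysis and Gauss sums there. The diagonal of `D7` has exponents
k(k-1)/2, hence inner products between vectors of distinct bases `H7 a`, `H7 b` are Gauss sums of
modulus √7 over 7. The Gauss sums of the two lower blocks are opposite; the minus sign of the fourth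
block makes them equal, and dephasing leaves only seventh roots of unity.

The heart is `S14_rigid`: every solution of the linearised unitarity equations has the form r i + s
j, a mere rephasing. Equations within a block row or block column, summed against a character over
pairs at a fixed difference, relate Fourier coefficients of two blocks. Equations between an upper
and a lower row, after completing squares, relate all four blocks. The system decouples: each (x, y)
gives five equations in four unknowns. Off the lines x = 0, y = 0, x + y = 0, x + 2y = 0,
elimination leaves one unknown times an explicit sum of seventh roots of unity, nonzero because
their only rational relation is 1 + ω + ⋯ + ω⁶ = 0. On the lines, a normalisation of the marginals
supplies what is missing (`char_system`).

Rigidity gives defect 0, and injectivity of a derivative turns this into isolation. It passes to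
equivalent matrices, so any matrix with a tangent direction not of the form r i + s j is
inequivalent to `S14`: Fourier, Diţă, positive-dimensional affine families. A phase-invariant
quotient of four entries excludes BH(14, r) with 7 ∤ r, and with it the dephased conference
matrices, which lie in BH(14, 4). -/

open scoped Matrix

namespace CHM

/-! ### The standard additive character of `ZMod 7` -/

/-- The additive character `x ↦ ω ^ x` of `ZMod 7`. -/
noncomputable abbrev ψ : AddChar (ZMod 7) ℂ := ZMod.stdAddChar

theorem seven_eq_zero : (7 : ZMod 7) = 0 := rfl

theorem psi_natCast (n : ℕ) : ψ (n : ZMod 7) = ω ^ n := by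
  have h := ZMod.stdAddChar_coe (N := 7) n
  rw [Int.cast_natCast] at h
  rw [h, ω, ← Complex.exp_nat_mul]
  congr 1
  push_cast
  ring

theorem psi_eq_pow_val (x : ZMod 7) : ψ x = ω ^ x.val := by
  rw [← psi_natCast, ZMod.natCast_val, ZMod.cast_id', id]

theorem norm_psi (x : ZMod 7) : ‖ψ x‖ = 1 := by
  rw [ZMod.stdAddChar_apply]; exact Circle.norm_coe _

theorem psi_ne_zero (x : ZMod 7) : ψ x ≠ 0 := by
  rw [← norm_ne_zero_iff, norm_psi]; exact one_ne_zero

theorem star_psi (x : ZMod 7) : star (ψ x) = ψ (-x) := by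
  rw [AddChar.map_neg_eq_inv, Complex.inv_def, Complex.normSq_eq_norm_sq, norm_psi]
  simp

theorem psi_eq_one_iff (x : ZMod 7) : ψ x = 1 ↔ x = 0 := by
  rw [← AddChar.map_zero_eq_one ψ]
  exact ZMod.injective_stdAddChar.eq_iff

theorem sum_psi_mul (c : ZMod 7) : ∑ x, ψ (c * x) = if c = 0 then 7 else 0 := by
  have h := AddChar.sum_mulShift (ψ := ψ) c (ZMod.isPrimitive_stdAddChar 7)
  simp only [mul_comm c]
  rw [h]
  simp [ZMod.card]

theorem sum_psi : ∑ x, ψ x = 0 := by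
  simpa [show (1 : ZMod 7) ≠ 0 by decide] using sum_psi_mul 1

theorem isPrimitiveRoot_omega : IsPrimitiveRoot ω 7 := by
  have := Complex.isPrimitiveRoot_exp 7 (by norm_num)
  simpa [ω] using this

/-- The only rational relations between the seventh roots of unity are the multiples of
`1 + ω + ⋯ + ω ^ 6 = 0`. -/
theorem coeff_eq_of_sum_psi_eq_zero (c : ZMod 7 → ℤ) (h : ∑ x, (c x : ℂ) * ψ x = 0)
    (x : ZMod 7) : c x = c 6 := by
  -- Subtracting `c 6` times the vanishing sum of all `ψ x` leaves a polynomial of degree at most 5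
  -- with root ω, below the degree 6 of its minimal polynomial.
  have h' : ∑ x, ((c x - c 6 : ℤ) : ℂ) * ψ x = 0 := by
    push_cast
    simp only [sub_mul, Finset.sum_sub_distrib, h, ← Finset.mul_sum, sum_psi, mul_zero, sub_zero]
  let p : Polynomial ℚ := ∑ x : ZMod 7, Polynomial.C ((c x - c 6 : ℤ) : ℚ) * Polynomial.X ^ x.val
  have hp : Polynomial.aeval ω p = 0 := by
    rw [← h']
    simp only [p, map_sum, map_mul, Polynomial.aeval_C, map_pow, Polynomial.aeval_X, psi_eq_pow_val]
    simp
  have hcoeff : ∀ y : ZMod 7, p.coeff y.val = ((c y - c 6 : ℤ) : ℚ) := by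
    intro y
    simp only [p, Polynomial.finsetSum_coeff, Polynomial.coeff_C_mul_X_pow]
    rw [Finset.sum_eq_single y]
    · simp
    · intro b _ hb
      rw [if_neg]
      exact fun h => hb (ZMod.val_injective 7 h.symm)
    · simp
  have hdeg : p.degree < 6 := by
    refine (Polynomial.degree_lt_iff_coeff_zero p 6).2 ?_
    intro m hm
    rcases eq_or_lt_of_le hm with rfl | hm
    · have := hcoeff 6
      rw [show (6 : ZMod 7).val = 6 from rfl] at this
      simpa using this
    · simp only [p, Polynomial.finsetSum_coeff, Polynomial.coeff_C_mul_X_pow]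
      refine Finset.sum_eq_zero fun b _ => if_neg ?_
      have := ZMod.val_lt b
      omega
  have hp0 : p = 0 := by
    by_contra hne
    have h1 := minpoly.degree_le_of_ne_zero ℚ ω hne hp
    rw [← Polynomial.cyclotomic_eq_minpoly_rat isPrimitiveRoot_omega (by norm_num),
      Polynomial.degree_cyclotomic, Nat.totient_prime (by norm_num)] at h1
    exact absurd (lt_of_le_of_lt h1 hdeg) (by norm_num)
  have := hcoeff x
  rw [hp0, Polynomial.coeff_zero] at this
  have : c x - c 6 = 0 := by exact_mod_cast this.symm
  omega

/-! ### Integral combinations of seventh roots of unity -/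

/-- A formal integral combination of the values of `ψ`. -/
abbrev PsiSum := List (ℤ × ZMod 7)

namespace PsiSum

/-- The value of a formal combination. -/
noncomputable def eval (l : PsiSum) : ℂ := (l.map fun p => (p.1 : ℂ) * ψ p.2).sum

/-- The total coefficient of `ψ r`. -/
def coeff (l : PsiSum) (r : ZMod 7) : ℤ := (l.map fun p => if p.2 = r then p.1 else 0).sum

/-- The product of two formal combinations. -/
def mul (l l' : PsiSum) : PsiSum :=
  l.flatMap fun p => l'.map fun q => (p.1 * q.1, p.2 + q.2)

theorem eval_cons (p : ℤ × ZMod 7) (l : PsiSum) : eval (p :: l) = p.1 * ψ p.2 + eval l := by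
  simp [eval]

theorem eval_nil : eval [] = 0 := rfl

theorem eval_append (l l' : PsiSum) : eval (l ++ l') = eval l + eval l' := by
  simp [eval]

theorem eval_mul (l l' : PsiSum) : eval (mul l l') = eval l * eval l' := by
  induction l with
  | nil => simp [mul, eval]
  | cons p l ih =>
    have h : mul (p :: l) l' = (l'.map fun q => (p.1 * q.1, p.2 + q.2)) ++ mul l l' := rfl
    rw [h, eval_append, ih, eval_cons, add_mul]
    congr 1
    clear ih h
    induction l' with
    | nil => simp [eval]
    | cons q l' ih =>
      rw [List.map_cons, eval_cons, eval_cons, ih, AddChar.map_add_eq_mul]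
      push_cast
      ring

theorem eval_eq_sum_coeff (l : PsiSum) : eval l = ∑ r, (coeff l r : ℂ) * ψ r := by
  induction l with
  | nil => simp [eval, coeff]
  | cons p l ih =>
    have h : ∀ r, coeff (p :: l) r = (if p.2 = r then p.1 else 0) + coeff l r := fun r => by
      simp [coeff]
    simp only [eval_cons, ih, h]
    push_cast
    simp [add_mul, Finset.sum_add_distrib]

/-- Reduces non-vanishing to a decidable comparison of integers: a zero value would make all seven
coefficients equal. -/
theorem eval_ne_zero {l : PsiSum} {r : ZMod 7} (h : coeff l r ≠ coeff l 6) : eval l ≠ 0 :=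
  fun h0 => h (coeff_eq_of_sum_psi_eq_zero _ (by rw [← eval_eq_sum_coeff, h0]) r)

end PsiSum

/-! ### Quadratic Gauss sums -/

/-- Completing the square: 3(z - v)² - 3v² = 3z² - 6vz, and -6 = 1 in `ZMod 7`. -/
theorem sum_psi_three (v : ZMod 7) :
    ∑ z, ψ (3 * z ^ 2 + v * z) = ψ (-3 * v ^ 2) * ∑ z, ψ (3 * z ^ 2) := by
  rw [← Equiv.sum_comp (Equiv.subRight v) (fun z => ψ (3 * z ^ 2)), Finset.mul_sum]
  refine Finset.sum_congr rfl fun z _ => ?_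
  rw [← AddChar.map_add_eq_mul]
  congr 1
  simp only [Equiv.subRight_apply]
  linear_combination v * z * seven_eq_zero

theorem sum_psi_four (v : ZMod 7) :
    ∑ z, ψ (4 * z ^ 2 + v * z) = ψ (-4 * v ^ 2) * ∑ z, ψ (4 * z ^ 2) := by
  rw [← Equiv.sum_comp (Equiv.addRight v) (fun z => ψ (4 * z ^ 2)), Finset.mul_sum]
  refine Finset.sum_congr rfl fun z _ => ?_
  rw [← AddChar.map_add_eq_mul]
  congr 1
  simp only [Equiv.coe_addRight]
  linear_combination -v * z * seven_eq_zero

/-- A nondegenerate quadratic Gauss sum has absolute value `√7`. -/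
theorem normSq_sum_psi_quadratic {c : ZMod 7} (hc : c ≠ 0) (n : ZMod 7) :
    ‖∑ z, ψ (c * z ^ 2 + n * z)‖ ^ 2 = 7 := by
  have key : (∑ z, ψ (c * z ^ 2 + n * z)) * star (∑ z, ψ (c * z ^ 2 + n * z)) = 7 := by
    rw [star_sum, Finset.sum_mul_sum, Finset.sum_comm]
    simp only [star_psi, ← AddChar.map_add_eq_mul]
    -- The substitution z = t + w makes the exponent linear in w, so summing over w leaves only the
    -- t with 2ct = 0.
    have h : ∀ w : ZMod 7, ∑ z, ψ (c * z ^ 2 + n * z + -(c * w ^ 2 + n * w)) =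
        ∑ t, ψ (c * t ^ 2 + n * t) * ψ ((2 * c * t) * w) := fun w => by
      rw [← Equiv.sum_comp (Equiv.addRight w)]
      refine Finset.sum_congr rfl fun t _ => ?_
      rw [← AddChar.map_add_eq_mul]
      congr 1
      simp only [Equiv.coe_addRight]
      ring
    simp only [h]
    rw [Finset.sum_comm]
    simp only [← Finset.mul_sum, sum_psi_mul]
    rw [Finset.sum_eq_single 0]
    · simp
    · intro t _ ht
      rw [if_neg, mul_zero]
      exact (by decide : ∀ c t : ZMod 7, c ≠ 0 → t ≠ 0 → 2 * c * t ≠ 0) c t hc ht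
    · simp
  have h2 := Complex.mul_conj (∑ z, ψ (c * z ^ 2 + n * z))
  rw [starRingEnd_apply, key, Complex.normSq_eq_norm_sq] at h2
  exact_mod_cast h2.symm

theorem sum_psi_three_sq_ne_zero : ∑ z, ψ (3 * z ^ 2) ≠ 0 := fun h => by
  have := normSq_sum_psi_quadratic (c := 3) (by decide) 0
  simp [h] at this

/-- Modulo 7, 4 is a square and 3 is not, so 4z² and 3z² together run over every residue exactly
twice. -/
theorem sum_psi_four_sq : ∑ z, ψ (4 * z ^ 2) = -∑ z, ψ (3 * z ^ 2) := by
  rw [eq_neg_iff_add_eq_zero, ← Finset.sum_add_distrib]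
  have h : ∀ f : ZMod 7 → ℂ, ∑ z : ZMod 7, f z = f 0 + f 1 + f 2 + f 3 + f 4 + f 5 + f 6 :=
    fun f => Fin.sum_univ_seven f
  have h0 := sum_psi
  rw [h] at h0 ⊢
  rw [show (4 * 0 ^ 2 : ZMod 7) = 0 by decide, show (4 * 1 ^ 2 : ZMod 7) = 4 by decide,
    show (4 * 2 ^ 2 : ZMod 7) = 2 by decide, show (4 * 3 ^ 2 : ZMod 7) = 1 by decide,
    show (4 * 4 ^ 2 : ZMod 7) = 1 by decide, show (4 * 5 ^ 2 : ZMod 7) = 2 by decide,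
    show (4 * 6 ^ 2 : ZMod 7) = 4 by decide, show (3 * 0 ^ 2 : ZMod 7) = 0 by decide,
    show (3 * 1 ^ 2 : ZMod 7) = 3 by decide, show (3 * 2 ^ 2 : ZMod 7) = 5 by decide,
    show (3 * 3 ^ 2 : ZMod 7) = 6 by decide, show (3 * 4 ^ 2 : ZMod 7) = 6 by decide,
    show (3 * 5 ^ 2 : ZMod 7) = 5 by decide, show (3 * 6 ^ 2 : ZMod 7) = 3 by decide]
  linear_combination 2 * h0

/-! ### The linearised unitarity equations of a `2 × 2` block matrix over `ZMod 7` -/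

/-- The Fourier transform on `ZMod 7 × ZMod 7`. -/
noncomputable def ft (R : ZMod 7 → ZMod 7 → ℂ) (x y : ZMod 7) : ℂ :=
  ∑ i, ∑ m, ψ (x * i + y * m) * R i m

theorem ft_swap (R : ZMod 7 → ZMod 7 → ℂ) (x y : ZMod 7) :
    ft (fun i m => R m i) x y = ft R y x := by
  unfold ft
  rw [Finset.sum_comm]
  simp only [add_comm]

theorem eq_zero_of_sum_psi_mul_eq_zero {f : ZMod 7 → ℂ} (h : ∀ x, ∑ i, ψ (x * i) * f i = 0)
    (i : ZMod 7) : f i = 0 := by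
  have h1 : ∑ x, ψ (-(x * i)) * ∑ j, ψ (x * j) * f j = 7 * f i := by
    simp only [Finset.mul_sum, ← mul_assoc, ← AddChar.map_add_eq_mul]
    rw [Finset.sum_comm]
    have h2 : ∀ j, ∑ x, ψ (-(x * i) + x * j) * f j = (if j - i = 0 then 7 else 0) * f j := by
      intro j
      rw [← sum_psi_mul, Finset.sum_mul]
      refine Finset.sum_congr rfl fun x _ => ?_
      congr 2
      ring
    simp only [h2, sub_eq_zero]
    simp
  simpa [h] using h1.symm

theorem eq_zero_of_ft_eq_zero {R : ZMod 7 → ZMod 7 → ℂ} (h : ∀ x y, ft R x y = 0)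
    (i m : ZMod 7) : R i m = 0 := by
  refine eq_zero_of_sum_psi_mul_eq_zero (f := R i) (fun y => ?_) m
  refine eq_zero_of_sum_psi_mul_eq_zero (f := fun i => ∑ m, ψ (y * m) * R i m) (fun x => ?_) i
  rw [← h x y, ft]
  refine Finset.sum_congr rfl fun i _ => ?_
  rw [Finset.mul_sum]
  refine Finset.sum_congr rfl fun m _ => ?_
  rw [AddChar.map_add_eq_mul, mul_assoc]

/-- A shift by t in the first argument multiplies a Fourier coefficient by `ψ (-(x * t))`. The
constant κ absorbs the constant part of an exponent difference. -/
theorem sum_psi_mul_shift_sub (R : ZMod 7 → ZMod 7 → ℂ) (κ x y t : ZMod 7) :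
    ∑ j, ∑ m, ψ (κ + x * j + y * m) * (R (j + t) m - R j m) =
      ψ κ * (ψ (-(x * t)) - 1) * ft R x y := by
  simp only [mul_sub, Finset.sum_sub_distrib]
  rw [← Equiv.sum_comp (Equiv.subRight t), mul_one, sub_mul]
  simp only [ft, Finset.mul_sum]
  congr 1
  all_goals
    refine Finset.sum_congr rfl fun j _ => Finset.sum_congr rfl fun m _ => ?_
    simp only [← mul_assoc, ← AddChar.map_add_eq_mul, Equiv.subRight_apply, sub_add_cancel]
    congr 2
    ring

theorem sum_kernel_mul (R : ZMod 7 → ZMod 7 → ℂ) (K : ZMod 7 → ZMod 7 → ZMod 7 → ℂ) (g : ℂ)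
    (x y : ZMod 7) (hK : ∀ i m, ∑ j, K i j m = g * ψ (x * i + y * m)) :
    ∑ i, ∑ j, ∑ m, K i j m * R i m = g * ft R x y := by
  rw [ft, Finset.mul_sum]
  refine Finset.sum_congr rfl fun i _ => ?_
  rw [Finset.sum_comm, Finset.mul_sum]
  refine Finset.sum_congr rfl fun m _ => ?_
  rw [← Finset.sum_mul, hK, mul_assoc]

instance : Fact (Nat.Prime 7) := ⟨by norm_num⟩

/-- Exponents of the block `F₇` of `S₁₄`. -/
def expEF (i m : ZMod 7) : ZMod 7 := i * m

/-- Exponents of the block `L₁` of `S₁₄`. -/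
def expEL (i m : ZMod 7) : ZMod 7 := i ^ 2 - i + i * m

/-- Exponents of the dephased block `K₁† F₇` of `S₁₄`. -/
def expKF (i m : ZMod 7) : ZMod 7 := 4 * m ^ 2 - i * m + 4 * m

/-- Exponents of the dephased block `-K₁† L₁` of `S₁₄`. -/
def expKL (i m : ZMod 7) : ZMod 7 := 3 * m ^ 2 + i * m + 4 * m - i ^ 2 + 5

/-! ### Relations between the Fourier coefficients of the four blocks -/

section Blocks

variable {a b c d : ZMod 7 → ZMod 7 → ℂ}

/-- For rows j + y and j the exponents differ by ym in the first block and by ym + 2yj + y² - y in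
the second. The weight `ψ (x * j)` therefore produces the frequencies (x, y) and (x + 2y, y). -/
theorem ft_relation_ef_el
    (h : ∀ i j, ∑ m, ψ (expEF i m - expEF j m) * (a i m - a j m) +
      ∑ m, ψ (expEL i m - expEL j m) * (b i m - b j m) = 0) (x y : ZMod 7) :
    (ψ (-(x * y)) - 1) * ft a x y +
      ψ (y ^ 2 - y) * (ψ (-((x + 2 * y) * y)) - 1) * ft b (x + 2 * y) y = 0 := by
  have h1 := sum_psi_mul_shift_sub a 0 x y y
  have h2 := sum_psi_mul_shift_sub b (y ^ 2 - y) (x + 2 * y) y y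
  rw [AddChar.map_zero_eq_one, one_mul] at h1
  rw [← h1, ← h2, ← Finset.sum_add_distrib]
  refine Finset.sum_eq_zero fun j _ => ?_
  rw [← mul_zero (ψ (x * j)), ← h (j + y) j, mul_add, Finset.mul_sum, Finset.mul_sum]
  congr 1
  all_goals
    refine Finset.sum_congr rfl fun m _ => ?_
    rw [← mul_assoc, ← AddChar.map_add_eq_mul]
    congr 2
    simp only [expEF, expEL]
    ring

/-- Same mechanism with row shift -(x + y) and weight `ψ (-x * j)`, chosen so that the frequencies
of c and d are those reached from a and b by the column relations. -/
theorem ft_relation_kf_kl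
    (h : ∀ i j, ∑ m, ψ (expKF i m - expKF j m) * (c i m - c j m) +
      ∑ m, ψ (expKL i m - expKL j m) * (d i m - d j m) = 0) (x y : ZMod 7) :
    (ψ (-(x * (x + y))) - 1) * ft c (-x) (x + y) +
      ψ (-(x + y) ^ 2) * (ψ ((x + y) * (x + 2 * y)) - 1) * ft d (x + 2 * y) (-(x + y)) = 0 := by
  have h1 := sum_psi_mul_shift_sub c 0 (-x) (x + y) (-(x + y))
  have h2 := sum_psi_mul_shift_sub d (-(x + y) ^ 2) (x + 2 * y) (-(x + y)) (-(x + y))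
  rw [AddChar.map_zero_eq_one, one_mul] at h1
  rw [show -(x * (x + y)) = -(-x * -(x + y)) by ring,
    show (x + y) * (x + 2 * y) = -((x + 2 * y) * -(x + y)) by ring, ← h1, ← h2,
    ← Finset.sum_add_distrib]
  refine Finset.sum_eq_zero fun j _ => ?_
  rw [← mul_zero (ψ (-x * j)), ← h (j + -(x + y)) j, mul_add, Finset.mul_sum, Finset.mul_sum]
  congr 1
  all_goals
    refine Finset.sum_congr rfl fun m _ => ?_
    rw [← mul_assoc, ← AddChar.map_add_eq_mul]
    congr 2
    simp only [expKF, expKL]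
    ring

/-- Columns j + x and j with weight `ψ (y * j)`; the term 8jx of the quadratic exponent reduces to
jx and moves the frequency of c from y to x + y. -/
theorem ft_relation_ef_kf
    (h : ∀ m n, ∑ i, ψ (expEF i m - expEF i n) * (a i m - a i n) +
      ∑ i, ψ (expKF i m - expKF i n) * (c i m - c i n) = 0) (x y : ZMod 7) :
    (ψ (-(x * y)) - 1) * ft a x y +
      ψ (4 * x ^ 2 + 4 * x) * (ψ (-(x * (x + y))) - 1) * ft c (-x) (x + y) = 0 := by
  have h1 := sum_psi_mul_shift_sub (fun m i => a i m) 0 y x x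
  have h2 := sum_psi_mul_shift_sub (fun m i => c i m) (4 * x ^ 2 + 4 * x) (x + y) (-x) x
  rw [AddChar.map_zero_eq_one, one_mul] at h1
  rw [ft_swap, mul_comm y x] at h1
  rw [ft_swap, mul_comm (x + y) x] at h2
  rw [← h1, ← h2, ← Finset.sum_add_distrib]
  refine Finset.sum_eq_zero fun j _ => ?_
  rw [← mul_zero (ψ (y * j)), ← h (j + x) j, mul_add, Finset.mul_sum, Finset.mul_sum]
  congr 1
  all_goals
    refine Finset.sum_congr rfl fun m _ => ?_
    rw [← mul_assoc, ← AddChar.map_add_eq_mul]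
    congr 2
    simp only [expEF, expKF]
  · ring
  · linear_combination -j * x * seven_eq_zero

theorem ft_relation_el_kl
    (h : ∀ m n, ∑ i, ψ (expEL i m - expEL i n) * (b i m - b i n) +
      ∑ i, ψ (expKL i m - expKL i n) * (d i m - d i n) = 0) (x y : ZMod 7) :
    (ψ (-((x + 2 * y) * y)) - 1) * ft b (x + 2 * y) y +
      ψ (3 * (x + 2 * y) ^ 2 + 4 * (x + 2 * y)) * (ψ ((x + y) * (x + 2 * y)) - 1) *
        ft d (x + 2 * y) (-(x + y)) = 0 := by
  have h1 := sum_psi_mul_shift_sub (fun m i => b i m) 0 y (x + 2 * y) (x + 2 * y)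
  have h2 := sum_psi_mul_shift_sub (fun m i => d i m) (3 * (x + 2 * y) ^ 2 + 4 * (x + 2 * y))
    (-(x + y)) (x + 2 * y) (x + 2 * y)
  rw [AddChar.map_zero_eq_one, one_mul] at h1
  rw [ft_swap, mul_comm y (x + 2 * y)] at h1
  rw [ft_swap, show -(-(x + y) * (x + 2 * y)) = (x + y) * (x + 2 * y) by ring] at h2
  rw [← h1, ← h2, ← Finset.sum_add_distrib]
  refine Finset.sum_eq_zero fun j _ => ?_
  rw [← mul_zero (ψ (y * j)), ← h (j + (x + 2 * y)) j, mul_add (ψ (y * j)), Finset.mul_sum,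
    Finset.mul_sum]
  congr 1
  all_goals
    refine Finset.sum_congr rfl fun m _ => ?_
    rw [← mul_assoc, ← AddChar.map_add_eq_mul]
    congr 2
    simp only [expEL, expKL]
  · ring
  · linear_combination -j * (x + 2 * y) * seven_eq_zero

theorem sum_psi_kernel_three (u v i m : ZMod 7) :
    ∑ j, ψ (u * i + v * j) * ψ (3 * (m - i - j + 4) ^ 2) =
      ψ (4 * v - 3 * v ^ 2) * (∑ z, ψ (3 * z ^ 2)) * ψ ((u - v) * i + v * m) := by
  have h := sum_psi_three (-v)
  rw [← Equiv.sum_comp (Equiv.subLeft (m - i + 4))]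
  calc _ = ∑ z, ψ (u * i + v * (m - i + 4)) * ψ (3 * z ^ 2 + -v * z) := by
        refine Finset.sum_congr rfl fun z _ => ?_
        simp only [← AddChar.map_add_eq_mul, Equiv.subLeft_apply]
        congr 1
        ring
    _ = _ := by
        rw [← Finset.mul_sum, h, mul_right_comm, ← mul_assoc, ← AddChar.map_add_eq_mul,
          ← AddChar.map_add_eq_mul]
        congr 2
        ring

theorem sum_psi_kernel_four (u v i m : ZMod 7) :
    ∑ j, ψ (u * i + v * j) * ψ (4 * (m + i - j - 4) ^ 2) =
      ψ (-4 * v - 4 * v ^ 2) * (∑ z, ψ (4 * z ^ 2)) * ψ ((u + v) * i + v * m) := by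
  have h := sum_psi_four (-v)
  rw [← Equiv.sum_comp (Equiv.subLeft (m + i - 4))]
  calc _ = ∑ z, ψ (u * i + v * (m + i - 4)) * ψ (4 * z ^ 2 + -v * z) := by
        refine Finset.sum_congr rfl fun z _ => ?_
        simp only [← AddChar.map_add_eq_mul, Equiv.subLeft_apply]
        congr 1
        ring
    _ = _ := by
        rw [← Finset.mul_sum, h, mul_right_comm, ← mul_assoc, ← AddChar.map_add_eq_mul,
          ← AddChar.map_add_eq_mul]
        congr 2
        ring

/-- For an upper row i and a lower row j the exponent differences are quadratics in m with leading
coefficients 3 and 4. The single factor `ψ (-(4 * (i + j - 4) ^ 2))` completes both squares. With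
the weight `ψ ((x + y) * i + y * j)`, summing over the row index that a block does not involve gives
a Gauss sum times a character. -/
theorem ft_relation_mixed
    (h : ∀ i j, ∑ m, ψ (expEF i m - expKF j m) * (a i m - c j m) +
      ∑ m, ψ (expEL i m - expKL j m) * (b i m - d j m) = 0) (x y : ZMod 7) :
    ψ (4 * y - 3 * y ^ 2) * ft a x y - ψ (4 * (x + y) - 3 * (x + y) ^ 2) * ft c (-x) (x + y) -
      ψ (-4 * y - 4 * y ^ 2) * ft b (x + 2 * y) y +
      ψ (4 * (x + y) - 4 * (x + y) ^ 2) * ft d (x + 2 * y) (-(x + y)) = 0 := by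
  have ha := sum_kernel_mul a
    (fun i j m => ψ ((x + y) * i + y * j) * ψ (3 * (m - i - j + 4) ^ 2)) _ x y fun i m => by
      rw [sum_psi_kernel_three, add_sub_cancel_right]
  have hc := sum_kernel_mul c
    (fun j i m => ψ ((x + y) * i + y * j) * ψ (3 * (m - i - j + 4) ^ 2))
      (ψ (4 * (x + y) - 3 * (x + y) ^ 2) * ∑ z, ψ (3 * z ^ 2)) (-x) (x + y) fun j m => by
      rw [show -x = y - (x + y) by ring, ← sum_psi_kernel_three]
      refine Finset.sum_congr rfl fun i _ => ?_
      rw [add_comm, sub_right_comm]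
  have hb := sum_kernel_mul b
    (fun i j m => ψ ((x + y) * i + y * j) * ψ (4 * (m + i - j - 4) ^ 2)) _ (x + 2 * y) y
      fun i m => by
      rw [sum_psi_kernel_four, show x + y + y = x + 2 * y by ring]
  have hd := sum_kernel_mul d
    (fun j i m => ψ ((x + y) * i + y * j) * ψ (4 * (m + i - j - 4) ^ 2))
      (ψ (4 * (x + y) - 4 * (x + y) ^ 2) * ∑ z, ψ (4 * z ^ 2)) (x + 2 * y) (-(x + y))
      fun j m => by
      -- The square is even and 4 = -3 in `ZMod 7`, so m + i - j - 4 may be replaced by (1 - m) + j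
      -- - i - 4, which exchanges the roles of i and j.
      have h1 := sum_psi_kernel_four y (x + y) j (1 - m)
      rw [mul_right_comm, ← AddChar.map_add_eq_mul] at h1 ⊢
      rw [show 4 * (x + y) - 4 * (x + y) ^ 2 + ((x + 2 * y) * j + -(x + y) * m) =
        -4 * (x + y) - 4 * (x + y) ^ 2 + ((y + (x + y)) * j + (x + y) * (1 - m)) by
          linear_combination (x + y) * seven_eq_zero, ← h1]
      refine Finset.sum_congr rfl fun i _ => ?_
      rw [← AddChar.map_add_eq_mul, ← AddChar.map_add_eq_mul]
      congr 1
      linear_combination (4 - 8 * (i - j + m)) * seven_eq_zero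
  have hsum : ∑ i, ∑ j, ψ ((x + y) * i + y * j) * ψ (-(4 * (i + j - 4) ^ 2)) *
      (∑ m, ψ (expEF i m - expKF j m) * (a i m - c j m) +
      ∑ m, ψ (expEL i m - expKL j m) * (b i m - d j m)) = 0 := by simp [h]
  have hexp : ∀ i j, ψ ((x + y) * i + y * j) * ψ (-(4 * (i + j - 4) ^ 2)) *
      (∑ m, ψ (expEF i m - expKF j m) * (a i m - c j m) +
      ∑ m, ψ (expEL i m - expKL j m) * (b i m - d j m)) =
      (∑ m, ψ ((x + y) * i + y * j) * ψ (3 * (m - i - j + 4) ^ 2) * a i m) -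
      (∑ m, ψ ((x + y) * i + y * j) * ψ (3 * (m - i - j + 4) ^ 2) * c j m) +
      ((∑ m, ψ ((x + y) * i + y * j) * ψ (4 * (m + i - j - 4) ^ 2) * b i m) -
      (∑ m, ψ ((x + y) * i + y * j) * ψ (4 * (m + i - j - 4) ^ 2) * d j m)) := by
    intro i j
    simp only [← Finset.sum_sub_distrib, mul_add, Finset.mul_sum, ← mul_sub]
    congr 1
    all_goals
      refine Finset.sum_congr rfl fun m _ => ?_
      simp only [← mul_assoc, ← AddChar.map_add_eq_mul]
      congr 2
      simp only [expEF, expKF, expEL, expKL]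
    · linear_combination (-(i + j - 4) ^ 2 + m * (i + j - 4) - m ^ 2 ) * seven_eq_zero
    · linear_combination (-i ^ 2 - j ^ 2 - 19 + 9 * i - i * m + j * m - m ^ 2 + 4 * m) *
        seven_eq_zero
  simp only [hexp, Finset.sum_add_distrib, Finset.sum_sub_distrib] at hsum
  have hc' := Finset.sum_comm.trans hc
  have hd' := Finset.sum_comm.trans hd
  rw [ha, hb, hc', hd', sum_psi_four_sq] at hsum
  -- The two Gauss sums are opposite, so one nonzero factor is common to all four terms.
  refine (mul_eq_zero.1 ?_).resolve_left sum_psi_three_sq_ne_zero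
  linear_combination hsum

/-! ### Solving the system at a single frequency -/

/-- The coefficient of the combined relation for a character outside the four special lines. -/
def mixedCoeff (x y : ZMod 7) : PsiSum :=
  let A : PsiSum := [(1, -(x * y)), (-1, 0)]
  let B : PsiSum := [(1, -((x + 2 * y) * y)), (-1, 0)]
  let C : PsiSum := [(1, -(x * (x + y))), (-1, 0)]
  let D : PsiSum := [(1, (x + y) * (x + 2 * y)), (-1, 0)]
  let fb : ZMod 7 := 3 * (x + 2 * y) ^ 2 + 4 * (x + 2 * y)
  let fc : ZMod 7 := -(x + y) ^ 2
  let fa : ZMod 7 := y ^ 2 - y + fb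
  PsiSum.mul [(1, 4 * y - 3 * y ^ 2 + fa)] (B.mul (C.mul D)) ++
    PsiSum.mul [(1, 4 * (x + y) - 3 * (x + y) ^ 2 + fc)] (A.mul (B.mul D)) ++
    PsiSum.mul [(1, -4 * y - 4 * y ^ 2 + fb)] (A.mul (C.mul D)) ++
    PsiSum.mul [(1, 4 * (x + y) - 4 * (x + y) ^ 2)] (A.mul (B.mul C))

theorem exists_coeff_mixedCoeff_ne : ∀ x y : ZMod 7, x ≠ 0 → y ≠ 0 → x + y ≠ 0 → x + 2 * y ≠ 0 →
    ∃ r, (mixedCoeff x y).coeff r ≠ (mixedCoeff x y).coeff 6 := by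
  decide +kernel

/-- Here s and t stand for x + y and x + 2y, and `hxy` to `hst` say that the lines meet only at the
origin. Some of A, B, C, D vanish on a line, but the normalisation kills an unknown there; the
two-block relations propagate this, and where they leave an unknown the mixed relation determines
it. -/
theorem char_system_line {x y s t : ZMod 7} {a b c d A B C D q₁ q₂ q₃ q₄ q₅ q₆ q₇ q₈ : ℂ}
    (hab : A * a + q₁ * B * b = 0) (hac : A * a + q₂ * C * c = 0) (hbd : B * b + q₃ * D * d = 0)
    (hcd : C * c + q₄ * D * d = 0) (hmix : q₅ * a - q₆ * c - q₇ * b + q₈ * d = 0)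
    (h₁ : q₁ ≠ 0) (h₂ : q₂ ≠ 0) (h₃ : q₃ ≠ 0) (h₄ : q₄ ≠ 0) (h₆ : q₆ ≠ 0) (h₇ : q₇ ≠ 0)
    (h₈ : q₈ ≠ 0) (hA : A = 0 ↔ x = 0 ∨ y = 0) (hB : B = 0 ↔ t = 0 ∨ y = 0)
    (hC : C = 0 ↔ x = 0 ∨ s = 0) (hD : D = 0 ↔ s = 0 ∨ t = 0)
    (hxy : x = 0 → y = 0 → s = 0 ∧ t = 0) (hxs : x = 0 → s = 0 → y = 0)
    (hys : y = 0 → s = 0 → x = 0) (hyt : y = 0 → t = 0 → x = 0) (hxt : x = 0 → t = 0 → y = 0)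
    (hst : s = 0 → t = 0 → y = 0) (ha : x = 0 ∨ y = 0 → a = 0) (hb : t = 0 → b = 0)
    (hc : s = 0 → c = 0) (h : x = 0 ∨ y = 0 ∨ s = 0 ∨ t = 0) :
    a = 0 ∧ b = 0 ∧ c = 0 ∧ d = 0 := by
  by_cases hx : x = 0
  · have ha0 := ha (Or.inl hx)
    have hC0 := hC.2 (Or.inl hx)
    by_cases hy : y = 0
    · have hb0 := hb (hxy hx hy).2
      have hc0 := hc (hxy hx hy).1
      exact ⟨ha0, hb0, hc0, by simpa [ha0, hb0, hc0, h₈] using hmix⟩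
    · have hB0 := mt hB.1 fun h => hy (h.elim (hxt hx) id)
      have hD0 := mt hD.1 fun h => hy (h.elim (hxs hx) (hxt hx))
      have hb0 : b = 0 := by simpa [ha0, h₁, hB0] using hab
      have hd0 : d = 0 := by simpa [hC0, h₄, hD0] using hcd
      exact ⟨ha0, hb0, by simpa [ha0, hb0, hd0, h₆] using hmix, hd0⟩
  by_cases hy : y = 0
  · have ha0 := ha (Or.inr hy)
    have hC0 := mt hC.1 fun h => hx (h.elim id (hys hy))
    have hD0 := mt hD.1 fun h => hx (h.elim (hys hy) (hyt hy))
    have hB0 := hB.2 (Or.inr hy)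
    have hc0 : c = 0 := by simpa [ha0, h₂, hC0] using hac
    have hd0 : d = 0 := by simpa [hB0, h₃, hD0] using hbd
    exact ⟨ha0, by simpa [ha0, hc0, hd0, h₇] using hmix, hc0, hd0⟩
  have hA0 := mt hA.1 fun h => h.elim hx hy
  by_cases hs : s = 0
  · have hc0 := hc hs
    have hB0 := mt hB.1 fun h => h.elim (fun ht => hy (hst hs ht)) hy
    have ha0 : a = 0 := by simpa [hc0, hA0] using hac
    have hb0 : b = 0 := by simpa [ha0, h₁, hB0] using hab
    exact ⟨ha0, hb0, hc0, by simpa [ha0, hb0, hc0, h₈] using hmix⟩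
  · have ht : t = 0 := ((h.resolve_left hx).resolve_left hy).resolve_left hs
    have hb0 := hb ht
    have hC0 := mt hC.1 fun h => h.elim hx hs
    have ha0 : a = 0 := by simpa [hb0, hA0] using hab
    have hc0 : c = 0 := by simpa [ha0, h₂, hC0] using hac
    exact ⟨ha0, hb0, hc0, by simpa [ha0, hb0, hc0, h₈] using hmix⟩

/-- The chain a – b – d – c of two-block relations expresses everything through d; after clearing
denominators the mixed relation says that the coefficient in `h` times D times d vanishes. -/
theorem char_system_generic {a b c d A B C D q₁ q₃ q₄ q₅ q₆ q₇ q₈ : ℂ}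
    (hab : A * a + q₁ * B * b = 0) (hbd : B * b + q₃ * D * d = 0)
    (hcd : C * c + q₄ * D * d = 0) (hmix : q₅ * a - q₆ * c - q₇ * b + q₈ * d = 0)
    (hA : A ≠ 0) (hB : B ≠ 0) (hC : C ≠ 0) (hD : D ≠ 0)
    (h : q₅ * (q₁ * q₃) * (B * (C * D)) + q₆ * q₄ * (A * (B * D)) + q₇ * q₃ * (A * (C * D)) +
      q₈ * (A * (B * C)) ≠ 0) :
    a = 0 ∧ b = 0 ∧ c = 0 ∧ d = 0 := by
  have hd : d = 0 := by
    refine (mul_eq_zero.1 ?_).resolve_left (mul_ne_zero h hD)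
    linear_combination (A * B * C * D) * hmix - q₅ * B * C * D * (hab - q₁ * hbd) +
      q₆ * A * B * D * hcd + q₇ * A * C * D * hbd
  have hc : c = 0 := by simpa [hd, hC] using hcd
  have hb : b = 0 := by simpa [hd, hB] using hbd
  exact ⟨by simpa [hb, hA] using hab, hb, hc, hd⟩

theorem char_system {x y : ZMod 7} {a b c d : ℂ}
    (hab : (ψ (-(x * y)) - 1) * a + ψ (y ^ 2 - y) * (ψ (-((x + 2 * y) * y)) - 1) * b = 0)
    (hac : (ψ (-(x * y)) - 1) * a + ψ (4 * x ^ 2 + 4 * x) * (ψ (-(x * (x + y))) - 1) * c = 0)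
    (hbd : (ψ (-((x + 2 * y) * y)) - 1) * b +
      ψ (3 * (x + 2 * y) ^ 2 + 4 * (x + 2 * y)) * (ψ ((x + y) * (x + 2 * y)) - 1) * d = 0)
    (hcd : (ψ (-(x * (x + y))) - 1) * c +
      ψ (-(x + y) ^ 2) * (ψ ((x + y) * (x + 2 * y)) - 1) * d = 0)
    (hmix : ψ (4 * y - 3 * y ^ 2) * a - ψ (4 * (x + y) - 3 * (x + y) ^ 2) * c -
      ψ (-4 * y - 4 * y ^ 2) * b + ψ (4 * (x + y) - 4 * (x + y) ^ 2) * d = 0)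
    (ha : x = 0 ∨ y = 0 → a = 0) (hb : x + 2 * y = 0 → b = 0) (hc : x + y = 0 → c = 0) :
    a = 0 ∧ b = 0 ∧ c = 0 ∧ d = 0 := by
  have hA : ψ (-(x * y)) - 1 = 0 ↔ x = 0 ∨ y = 0 := by
    rw [sub_eq_zero, psi_eq_one_iff, neg_eq_zero, mul_eq_zero]
  have hB : ψ (-((x + 2 * y) * y)) - 1 = 0 ↔ x + 2 * y = 0 ∨ y = 0 := by
    rw [sub_eq_zero, psi_eq_one_iff, neg_eq_zero, mul_eq_zero]
  have hC : ψ (-(x * (x + y))) - 1 = 0 ↔ x = 0 ∨ x + y = 0 := by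
    rw [sub_eq_zero, psi_eq_one_iff, neg_eq_zero, mul_eq_zero]
  have hD : ψ ((x + y) * (x + 2 * y)) - 1 = 0 ↔ x + y = 0 ∨ x + 2 * y = 0 := by
    rw [sub_eq_zero, psi_eq_one_iff, mul_eq_zero]
  have h5 : x = 0 → x + 2 * y = 0 → y = 0 := by
    rintro rfl h
    exact (mul_eq_zero.1 (by simpa using h)).resolve_left (by decide : (2 : ZMod 7) ≠ 0)
  have h6 : x + y = 0 → x + 2 * y = 0 → y = 0 := fun h h' => by linear_combination h' - h
  by_cases hlines : x = 0 ∨ y = 0 ∨ x + y = 0 ∨ x + 2 * y = 0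
  · exact char_system_line hab hac hbd hcd hmix (psi_ne_zero _) (psi_ne_zero _) (psi_ne_zero _)
      (psi_ne_zero _) (psi_ne_zero _) (psi_ne_zero _) (psi_ne_zero _) hA hB hC hD
      (by rintro rfl rfl; simp) (by rintro rfl h; simpa using h) (by rintro rfl h; simpa using h)
      (by rintro rfl h; simpa using h) h5 h6 ha hb hc hlines
  push Not at hlines
  obtain ⟨hx, hy, hs, ht⟩ := hlines
  obtain ⟨r, hr⟩ := exists_coeff_mixedCoeff_ne x y hx hy hs ht
  have hne := PsiSum.eval_ne_zero hr
  simp only [mixedCoeff, PsiSum.eval_append, PsiSum.eval_mul, PsiSum.eval_cons, PsiSum.eval_nil,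
    AddChar.map_add_eq_mul ψ (4 * y - 3 * y ^ 2), AddChar.map_add_eq_mul ψ (y ^ 2 - y),
    AddChar.map_add_eq_mul ψ (4 * (x + y) - 3 * (x + y) ^ 2),
    AddChar.map_add_eq_mul ψ (-4 * y - 4 * y ^ 2), AddChar.map_zero_eq_one, Int.cast_one,
    Int.cast_neg, one_mul, mul_one, add_zero] at hne
  simp only [← sub_eq_add_neg] at hne
  have hA' := mt hA.1 fun h => h.elim hx hy
  have hB' := mt hB.1 fun h => h.elim ht hy
  have hC' := mt hC.1 fun h => h.elim hx hs
  have hD' := mt hD.1 fun h => h.elim hs ht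
  exact char_system_generic hab hbd hcd hmix hA' hB' hC' hD' hne

/-- A solution of the linearised unitarity equations of `S₁₄`, normalised by the vanishing of some
of its marginals, is zero. -/
theorem eq_zero_of_block_equations
    (hee : ∀ i j, ∑ m, ψ (expEF i m - expEF j m) * (a i m - a j m) +
      ∑ m, ψ (expEL i m - expEL j m) * (b i m - b j m) = 0)
    (hkk : ∀ i j, ∑ m, ψ (expKF i m - expKF j m) * (c i m - c j m) +
      ∑ m, ψ (expKL i m - expKL j m) * (d i m - d j m) = 0)
    (hek : ∀ i j, ∑ m, ψ (expEF i m - expKF j m) * (a i m - c j m) +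
      ∑ m, ψ (expEL i m - expKL j m) * (b i m - d j m) = 0)
    (hff : ∀ m n, ∑ i, ψ (expEF i m - expEF i n) * (a i m - a i n) +
      ∑ i, ψ (expKF i m - expKF i n) * (c i m - c i n) = 0)
    (hll : ∀ m n, ∑ i, ψ (expEL i m - expEL i n) * (b i m - b i n) +
      ∑ i, ψ (expKL i m - expKL i n) * (d i m - d i n) = 0)
    (ha : ∀ i, ∑ m, a i m = 0) (ha' : ∀ m, ∑ i, a i m = 0) (hb : ∀ m, ∑ i, b i m = 0)
    (hc : ∀ i, ∑ m, c i m = 0) (i m : ZMod 7) :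
    a i m = 0 ∧ b i m = 0 ∧ c i m = 0 ∧ d i m = 0 := by
  have hrow : ∀ {R : ZMod 7 → ZMod 7 → ℂ}, (∀ i, ∑ m, R i m = 0) → ∀ x, ft R x 0 = 0 := by
    intro R hR x
    simp only [ft, zero_mul, add_zero, ← Finset.mul_sum, hR, mul_zero, Finset.sum_const_zero]
  have hcol : ∀ {R : ZMod 7 → ZMod 7 → ℂ}, (∀ m, ∑ i, R i m = 0) → ∀ y, ft R 0 y = 0 := by
    intro R hR y
    rw [← ft_swap]
    exact hrow hR y
  have key : ∀ x y, ft a x y = 0 ∧ ft b (x + 2 * y) y = 0 ∧ ft c (-x) (x + y) = 0 ∧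
      ft d (x + 2 * y) (-(x + y)) = 0 := by
    intro x y
    refine char_system (ft_relation_ef_el hee x y) (ft_relation_ef_kf hff x y)
      (ft_relation_el_kl hll x y) (ft_relation_kf_kl hkk x y) (ft_relation_mixed hek x y)
      ?_ ?_ ?_
    · rintro (rfl | rfl)
      exacts [hcol ha' y, hrow ha x]
    · intro h; rw [h]; exact hcol hb y
    · intro h; rw [h]; exact hrow hc _
  -- Each of the four frequencies is an invertible linear function of (x, y), so every Fourier
  -- coefficient of every block is covered.
  refine ⟨eq_zero_of_ft_eq_zero (fun x y => (key x y).1) i m,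
    eq_zero_of_ft_eq_zero (fun x y => ?_) i m, eq_zero_of_ft_eq_zero (fun x y => ?_) i m,
    eq_zero_of_ft_eq_zero (fun x y => ?_) i m⟩
  · simpa using (key (x - 2 * y) y).2.1
  · simpa using (key (-x) (x + y)).2.2.1
  · have := (key (-x - 2 * y) (x + y)).2.2.2
    rwa [show -x - 2 * y + 2 * (x + y) = x by ring, show -(-x - 2 * y + (x + y)) = y by ring]
      at this

end Blocks
/-! ### The mutually unbiased bases and the block matrix -/

theorem sqrt_natCast_ne_zero (n : ℕ) [NeZero n] : (√(n : ℝ) : ℂ) ≠ 0 := by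
  have : (0 : ℝ) < n := Nat.cast_pos.2 (Nat.pos_of_ne_zero (NeZero.ne n))
  exact_mod_cast (Real.sqrt_pos.2 this).ne'

theorem sqrt_natCast_mul_self (n : ℕ) : (√(n : ℝ) : ℂ) * (√(n : ℝ) : ℂ) = n := by
  exact_mod_cast Real.mul_self_sqrt (Nat.cast_nonneg n)

/-- The identification of `Fin 7` with `ZMod 7`. -/
def zc : Fin 7 ≃ ZMod 7 where
  toFun i := (i : ℕ)
  invFun x := ⟨x.val, x.val_lt⟩
  left_inv := by decide
  right_inv := by decide

theorem fourier_seven_apply (i j : Fin 7) :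
    fourier 7 i j = ψ (zc i * zc j) / (√((7 : ℕ) : ℝ) : ℂ) := by
  have h : (((i : ℕ) * (j : ℕ) : ℕ) : ZMod 7) = zc i * zc j := Nat.cast_mul _ _
  rw [fourier, Matrix.of_apply, ← h, psi_natCast, ω, Nat.cast_ofNat]

/-- The exponents 0, 0, 1, 3, 6, 3, 1 are the triangular numbers k(k-1)/2 modulo 7, and 1/2 = 4. -/
theorem D7_eq : D7 = Matrix.diagonal (fun k => ψ (4 * zc k ^ 2 - 4 * zc k)) := by
  have h : ∀ n : ℕ, ω ^ n = ψ (n : ZMod 7) := fun n => (psi_natCast n).symm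
  have h1 : ω = ψ ((1 : ℕ) : ZMod 7) := by rw [psi_natCast, pow_one]
  rw [D7]
  congr 1
  funext k
  rw [h, h, h1]
  fin_cases k <;> first | exact (AddChar.map_zero_eq_one ψ).symm | exact congrArg ψ (by decide)

theorem H7_apply (n : ℕ) (i j : Fin 7) :
    H7 n i j = ψ (n * (4 * zc i ^ 2 - 4 * zc i) + zc i * zc j) / (√((7 : ℕ) : ℝ) : ℂ) := by
  rw [H7, D7_eq, Matrix.diagonal_pow, Matrix.diagonal_mul, fourier_seven_apply, Pi.pow_apply,
    ← AddChar.map_nsmul_eq_pow, nsmul_eq_mul, mul_div_assoc', ← AddChar.map_add_eq_mul]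

theorem fourier_seven_eq : fourier 7 = H7 0 := by
  rw [H7, pow_zero, one_mul]

/-- The quadratic coefficient 4(b - a) decides everything: if it is zero a character sum gives
orthonormality, otherwise a Gauss sum gives unbiasedness. -/
theorem H7_conjTranspose_mul_apply (a b : ℕ) (i j : Fin 7) :
    ((H7 a)ᴴ * H7 b) i j =
      (∑ k, ψ ((4 * (b - a)) * k ^ 2 + (zc j - zc i - 4 * (b - a)) * k)) / 7 := by
  rw [Matrix.mul_apply, Finset.sum_div, ← zc.sum_comp]
  refine Finset.sum_congr rfl fun k _ => ?_
  rw [Matrix.conjTranspose_apply, H7_apply, H7_apply, star_div₀, star_psi, Complex.star_def,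
    Complex.conj_ofReal, div_mul_div_comm, sqrt_natCast_mul_self, ← AddChar.map_add_eq_mul,
    Nat.cast_ofNat]
  congr 2
  ring

theorem H7_conjTranspose_mul_self (a : ℕ) : (H7 a)ᴴ * H7 a = 1 := by
  ext i j
  rw [H7_conjTranspose_mul_apply, sub_self, mul_zero, sub_zero]
  simp only [zero_mul, zero_add]
  rw [sum_psi_mul, Matrix.one_apply]
  by_cases hij : i = j
  · simp [hij]
  · rw [if_neg hij, if_neg, zero_div]
    exact sub_ne_zero.2 (zc.injective.ne (Ne.symm hij))

theorem norm_H7_apply (a : ℕ) (i j : Fin 7) : ‖H7 a i j‖ = 1 / √((7 : ℕ) : ℝ) := by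
  rw [H7_apply, norm_div, norm_psi, Complex.norm_real, Real.norm_of_nonneg (Real.sqrt_nonneg _)]

theorem isMU_H7 {a b : ℕ} (h : (a : ZMod 7) ≠ b) : IsMU (H7 a) (H7 b) := by
  intro i j
  rw [H7_conjTranspose_mul_apply, norm_div, div_pow, normSq_sum_psi_quadratic]
  · norm_num
  · exact mul_ne_zero (by decide) (sub_ne_zero.2 h.symm)

theorem isCompleteMUSet_bases7 : IsCompleteMUSet bases7 := by
  refine ⟨by simp, ?_, ?_⟩
  · rintro (_ | i)
    · exact one_mem _
    · rw [Matrix.mem_unitaryGroup_iff']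
      exact H7_conjTranspose_mul_self i
  · have hsq : (1 / √((7 : ℕ) : ℝ)) ^ 2 = 1 / ((7 : ℕ) : ℝ) := by
      rw [div_pow, one_pow, Real.sq_sqrt (Nat.cast_nonneg _)]
    rintro (_ | i) (_ | j) hij
    · exact absurd rfl hij
    · intro k l
      rw [bases7, bases7, Matrix.conjTranspose_one, one_mul, norm_H7_apply, hsq]
    · intro k l
      rw [bases7, bases7, mul_one, Matrix.conjTranspose_apply, norm_star, norm_H7_apply, hsq]
    · exact isMU_H7 fun h => hij (congrArg some (zc.injective h))

theorem norm_apply_of_isMU {d : ℕ} {U V : Matrix (Fin d) (Fin d) ℂ} (h : IsMU U V) (i j : Fin d) :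
    ‖(Uᴴ * V) i j‖ = 1 / √(d : ℝ) := by
  rw [← Real.sqrt_sq (norm_nonneg _), h i j, Real.sqrt_div zero_le_one, Real.sqrt_one]

theorem isHadamard_H14 : IsHadamard (H14 (H7 1) (H7 2)) := by
  have hu : ∀ a, H7 a * (H7 a)ᴴ = 1 := fun a => mul_eq_one_comm.1 (H7_conjTranspose_mul_self a)
  have h2 : (√(2 : ℝ) : ℂ) * (√(2 : ℝ) : ℂ) = 2 := by exact_mod_cast sqrt_natCast_mul_self 2
  constructor
  · have hB : Matrix.fromBlocks (fourier 7) (H7 2) ((H7 1)ᴴ * fourier 7) (-((H7 1)ᴴ * H7 2)) *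
        (Matrix.fromBlocks (fourier 7) (H7 2) ((H7 1)ᴴ * fourier 7) (-((H7 1)ᴴ * H7 2)))ᴴ =
        (2 : ℂ) • 1 := by
      rw [Matrix.fromBlocks_conjTranspose, Matrix.fromBlocks_multiply, ← Matrix.fromBlocks_one,
        Matrix.fromBlocks_smul, fourier_seven_eq]
      simp only [Matrix.conjTranspose_mul, Matrix.conjTranspose_neg, Matrix.conjTranspose_conjTranspose,
        Matrix.mul_neg, Matrix.neg_mul, neg_neg]
      have e1 : ∀ a, H7 a * ((H7 a)ᴴ * H7 1) = H7 1 := fun a => by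
        rw [← Matrix.mul_assoc, hu, one_mul]
      congr 1
      · rw [hu, hu, two_smul]
      · rw [e1, e1, smul_zero, add_neg_cancel]
      · rw [Matrix.mul_assoc, Matrix.mul_assoc, hu, hu, smul_zero, add_neg_cancel]
      · rw [Matrix.mul_assoc, Matrix.mul_assoc, e1, e1, H7_conjTranspose_mul_self, two_smul]
    rw [H14, Matrix.conjTranspose_smul, Matrix.smul_mul, Matrix.mul_smul, Matrix.conjTranspose_reindex,
      Matrix.reindex_apply, Matrix.reindex_apply, Matrix.submatrix_mul_equiv, hB]
    have h3 : (1 / (√(2 : ℝ) : ℂ)) * (star (1 / (√(2 : ℝ) : ℂ)) * 2) = 1 := by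
      rw [star_div₀, star_one, Complex.star_def, Complex.conj_ofReal, ← mul_assoc,
        div_mul_div_comm, h2]
      norm_num
    rw [Matrix.submatrix_smul, Pi.smul_apply, Pi.smul_apply, Matrix.submatrix_one_equiv, smul_smul,
      smul_smul, mul_assoc, h3, one_smul]
  · intro i j
    obtain ⟨p, rfl⟩ := (finSumFinEquiv (m := 7) (n := 7)).surjective i
    obtain ⟨q, rfl⟩ := (finSumFinEquiv (m := 7) (n := 7)).surjective j
    have h : ‖Matrix.fromBlocks (fourier 7) (H7 2) ((H7 1)ᴴ * fourier 7) (-((H7 1)ᴴ * H7 2)) p q‖ =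
        1 / √((7 : ℕ) : ℝ) := by
      rw [fourier_seven_eq]
      rcases p with p | p <;> rcases q with q | q
      · exact norm_H7_apply _ _ _
      · exact norm_H7_apply _ _ _
      · exact norm_apply_of_isMU (isMU_H7 (by decide)) _ _
      · rw [Matrix.fromBlocks_apply₂₂, Matrix.neg_apply, norm_neg]
        exact norm_apply_of_isMU (isMU_H7 (by decide)) _ _
    rw [H14, Matrix.smul_apply, Matrix.reindex_apply, Matrix.submatrix_apply, Equiv.symm_apply_apply,
      Equiv.symm_apply_apply, norm_smul, h, norm_div, Complex.norm_real, norm_one,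
      Real.norm_of_nonneg (Real.sqrt_nonneg _), div_mul_div_comm, ← Real.sqrt_mul (by norm_num)]
    norm_num

/-- Exponents of `S₁₄`, indexed by blocks. -/
def blockExp : ZMod 7 ⊕ ZMod 7 → ZMod 7 ⊕ ZMod 7 → ZMod 7
  | .inl i, .inl m => expEF i m
  | .inl i, .inr m => expEL i m
  | .inr i, .inl m => expKF i m
  | .inr i, .inr m => expKL i m

/-- Rows and columns of `S₁₄`, indexed by blocks. -/
def blockIdx : ZMod 7 ⊕ ZMod 7 ≃ Fin 14 :=
  (Equiv.sumCongr zc zc).symm.trans (finSumFinEquiv (m := 7) (n := 7))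

theorem expS14_blockIdx : ∀ p q : ZMod 7 ⊕ ZMod 7,
    (expS14 (blockIdx p) (blockIdx q) : ZMod 7) = blockExp p q := by
  decide +kernel

theorem S14_blockIdx (p q : ZMod 7 ⊕ ZMod 7) :
    S14 (blockIdx p) (blockIdx q) = ψ (blockExp p q) / (√((14 : ℕ) : ℝ) : ℂ) := by
  rw [← expS14_blockIdx, psi_natCast]
  rfl

/-- Exponents of the block matrix, before dephasing. -/
def rawExp : ZMod 7 ⊕ ZMod 7 → ZMod 7 ⊕ ZMod 7 → ZMod 7
  | .inl i, .inl m => i * m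
  | .inl i, .inr m => 2 * (4 * i ^ 2 - 4 * i) + i * m
  | .inr i, .inl m => -3 * (4 + m - i) ^ 2
  | .inr i, .inr m => -4 * (m - i - 4) ^ 2

theorem rawExp_sub : ∀ p q : ZMod 7 ⊕ ZMod 7,
    rawExp p q + rawExp (.inl 0) (.inl 0) - (rawExp p (.inl 0) + rawExp (.inl 0) q) =
      blockExp p q := by
  decide +kernel

/-- The factor κ depends on the row only: the Gauss sum of the fourth block is opposite to that of
the third, and the sign of the block corrects it. Dephasing then cancels κ. -/
theorem H14_blockIdx : ∃ κ : ZMod 7 ⊕ ZMod 7 → ℂ, (∀ p, κ p ≠ 0) ∧ ∀ p q,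
    H14 (H7 1) (H7 2) (blockIdx p) (blockIdx q) = κ p * ψ (rawExp p q) := by
  have h2 : (√(2 : ℝ) : ℂ) ≠ 0 := by exact_mod_cast sqrt_natCast_ne_zero 2
  have h7 := sqrt_natCast_ne_zero 7
  have hG := sum_psi_three_sq_ne_zero
  refine ⟨Sum.elim (fun _ => 1 / √(2 : ℝ) / (√((7 : ℕ) : ℝ) : ℂ))
    (fun _ => 1 / √(2 : ℝ) * ((∑ z, ψ (3 * z ^ 2)) / 7)), ?_, ?_⟩
  · rintro (p | p)
    · exact div_ne_zero (one_div_ne_zero h2) h7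
    · exact mul_ne_zero (one_div_ne_zero h2) (div_ne_zero hG (by norm_num))
  · intro p q
    obtain ⟨p, rfl⟩ := (Equiv.sumCongr zc zc).surjective p
    obtain ⟨q, rfl⟩ := (Equiv.sumCongr zc zc).surjective q
    rw [H14, blockIdx, Matrix.smul_apply, Matrix.reindex_apply, Matrix.submatrix_apply,
      Equiv.trans_apply, Equiv.trans_apply, Equiv.symm_apply_apply, Equiv.symm_apply_apply,
      Equiv.symm_apply_apply, Equiv.symm_apply_apply, smul_eq_mul, fourier_seven_eq]
    rcases p with i | i <;> rcases q with m | m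
    · simp only [Matrix.fromBlocks_apply₁₁, H7_apply, Equiv.sumCongr_apply, Sum.map_inl,
        Sum.elim_inl, rawExp, Nat.cast_zero, zero_mul, zero_add]
      ring
    · simp only [Matrix.fromBlocks_apply₁₂, H7_apply, Equiv.sumCongr_apply, Sum.map_inl,
        Sum.map_inr, Sum.elim_inl, rawExp, Nat.cast_ofNat]
      ring
    · have h : ∀ k : ZMod 7, 4 * ((0 : ℕ) - (1 : ℕ)) * k ^ 2 +
          (zc m - zc i - 4 * ((0 : ℕ) - (1 : ℕ))) * k = 3 * k ^ 2 + (4 + zc m - zc i) * k :=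
        fun k => by
          push_cast
          linear_combination (-k ^ 2) * seven_eq_zero
      simp only [Matrix.fromBlocks_apply₂₁, H7_conjTranspose_mul_apply, h, sum_psi_three,
        Equiv.sumCongr_apply, Sum.map_inl, Sum.map_inr, Sum.elim_inr, rawExp]
      ring
    · have h : ∀ k : ZMod 7, 4 * ((2 : ℕ) - (1 : ℕ)) * k ^ 2 +
          (zc m - zc i - 4 * ((2 : ℕ) - (1 : ℕ))) * k = 4 * k ^ 2 + (zc m - zc i - 4) * k :=
        fun k => by
          push_cast
          ring
      simp only [Matrix.fromBlocks_apply₂₂, Matrix.neg_apply, H7_conjTranspose_mul_apply, h,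
        sum_psi_four, sum_psi_four_sq, Equiv.sumCongr_apply, Sum.map_inr, Sum.elim_inr, rawExp]
      ring

theorem dephase_H14 : dephase (H14 (H7 1) (H7 2)) = S14 := by
  obtain ⟨κ, hκ, h⟩ := H14_blockIdx
  ext i j
  obtain ⟨p, rfl⟩ := blockIdx.surjective i
  obtain ⟨q, rfl⟩ := blockIdx.surjective j
  rw [S14_blockIdx, dephase, Matrix.of_apply, show (0 : Fin 14) = blockIdx (.inl 0) from rfl]
  simp only [h]
  congr 1
  rw [← rawExp_sub, AddChar.map_sub_eq_div, AddChar.map_add_eq_mul, AddChar.map_add_eq_mul]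
  have := hκ p
  have := hκ (.inl 0)
  have := psi_ne_zero (rawExp p (.inl 0))
  have := psi_ne_zero (rawExp (.inl 0) q)
  field_simp

/-! ### Hadamard matrices, dephasing and infinitesimal deformations -/

section Hadamard

variable {n : ℕ}

theorem IsHadamard.apply_ne_zero [NeZero n] {H : Matrix (Fin n) (Fin n) ℂ} (hH : IsHadamard H)
    (i j : Fin n) : H i j ≠ 0 := by
  rw [← norm_ne_zero_iff, hH.2 i j]
  have : (0 : ℝ) < n := Nat.cast_pos.2 (Nat.pos_of_ne_zero (NeZero.ne n))
  positivity

theorem IsHadamard.sum_mul_star {H : Matrix (Fin n) (Fin n) ℂ} (hH : IsHadamard H)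
    (i j : Fin n) : ∑ k, H i k * star (H j k) = if i = j then 1 else 0 := by
  rw [← Matrix.one_apply, ← hH.1, Matrix.mul_apply]
  simp only [Matrix.conjTranspose_apply]

theorem isHadamard_of_phases [NeZero n] {H K : Matrix (Fin n) (Fin n) ℂ} (hH : IsHadamard H)
    (c d : Fin n → ℂ) (hc : ∀ i, ‖c i‖ = 1) (hd : ∀ i, ‖d i‖ = 1)
    (hK : ∀ i j, K i j = c i * H i j * d j) : IsHadamard K := by
  constructor
  · ext i j
    have h : ∀ k, K i k * star (K j k) = c i * star (c j) * (H i k * star (H j k)) := fun k => by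
      have : d k * star (d k) = 1 := by
        rw [Complex.star_def, Complex.mul_conj, Complex.normSq_eq_norm_sq, hd]; simp
      rw [hK, hK, star_mul', star_mul']
      linear_combination (c i * star (c j) * H i k * star (H j k)) * this
    rw [Matrix.mul_apply]
    simp only [Matrix.conjTranspose_apply, h, ← Finset.mul_sum, hH.sum_mul_star, Matrix.one_apply]
    split_ifs with hij
    · rw [hij, mul_one, Complex.star_def, Complex.mul_conj, Complex.normSq_eq_norm_sq, hc]; simp
    · rw [mul_zero]
  · intro i j
    rw [hK, norm_mul, norm_mul, hc, hd, hH.2, one_mul, mul_one]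

theorem norm_sqrt_mul_apply [NeZero n] {H : Matrix (Fin n) (Fin n) ℂ} (hH : IsHadamard H)
    (i j : Fin n) : ‖(√(n : ℝ) : ℂ) * H i j‖ = 1 := by
  have := sqrt_natCast_ne_zero n
  rw [norm_mul, hH.2, Complex.norm_real, Real.norm_of_nonneg (Real.sqrt_nonneg _)]
  rw [Complex.ofReal_ne_zero] at this
  field_simp

theorem norm_apply_div_apply [NeZero n] {H : Matrix (Fin n) (Fin n) ℂ} (hH : IsHadamard H)
    (i j k l : Fin n) : ‖H i j / H k l‖ = 1 := by
  have := norm_ne_zero_iff.2 (hH.apply_ne_zero k l)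
  rw [norm_div, hH.2 i j, ← hH.2 k l, div_self this]

theorem isHadamard_dephase [NeZero n] {H : Matrix (Fin n) (Fin n) ℂ} (hH : IsHadamard H) :
    IsHadamard (dephase H) := by
  refine isHadamard_of_phases hH (fun i => ((√(n : ℝ) : ℂ) * H i 0)⁻¹) (fun j => H 0 0 / H 0 j)
    (fun i => by rw [norm_inv, norm_sqrt_mul_apply hH, inv_one])
    (fun j => norm_apply_div_apply hH _ _ _ _) fun i j => ?_
  have := sqrt_natCast_ne_zero n
  have := hH.apply_ne_zero
  rw [dephase, Matrix.of_apply]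
  field_simp

/-- `R` satisfies the unitarity conditions for `H ∘ EXP(i R)` to first order. -/
def IsTangent (H : Matrix (Fin n) (Fin n) ℂ) (R : Matrix (Fin n) (Fin n) ℝ) : Prop :=
  ∀ i j, ∑ k, H i k * star (H j k) * ((R i k : ℂ) - (R j k : ℂ)) = 0

theorem IsTangent.sub {H : Matrix (Fin n) (Fin n) ℂ} {R R' : Matrix (Fin n) (Fin n) ℝ}
    (h : IsTangent H R) (h' : IsTangent H R') : IsTangent H (R - R') := by
  intro i j
  rw [← sub_zero (0 : ℂ)]
  nth_rewrite 1 [← h i j]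
  rw [← h' i j, ← Finset.sum_sub_distrib]
  refine Finset.sum_congr rfl fun k _ => ?_
  simp only [Matrix.sub_apply, Complex.ofReal_sub]
  ring

theorem isTangent_add {H : Matrix (Fin n) (Fin n) ℂ} (hH : IsHadamard H) (r s : Fin n → ℝ) :
    IsTangent H (Matrix.of fun i j => r i + s j) := by
  intro i j
  simp only [Matrix.of_apply, Complex.ofReal_add, add_sub_add_right_eq_sub, ← Finset.sum_mul,
    hH.sum_mul_star]
  split_ifs with hij
  · rw [hij, sub_self, mul_zero]
  · rw [zero_mul]

/-- With G = H ∘ R, tangency says that G Hᴴ is Hermitian. Conjugating by the unitary H makes Hᴴ G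
Hermitian, which is tangency for the transposes. -/
theorem IsTangent.transpose {H : Matrix (Fin n) (Fin n) ℂ} {R : Matrix (Fin n) (Fin n) ℝ}
    (h : IsTangent H R) (hH : H * Hᴴ = 1) : IsTangent Hᵀ Rᵀ := by
  let G : Matrix (Fin n) (Fin n) ℂ := Matrix.of fun i j => H i j * R i j
  have h1 : G * Hᴴ = H * Gᴴ := by
    ext i j
    rw [Matrix.mul_apply, Matrix.mul_apply, ← sub_eq_zero, ← Finset.sum_sub_distrib, ← h i j]
    refine Finset.sum_congr rfl fun k _ => ?_
    simp only [G, Matrix.conjTranspose_apply, Matrix.of_apply, star_mul', Complex.star_def,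
      Complex.conj_ofReal]
    ring
  have hH' : Hᴴ * H = 1 := mul_eq_one_comm.1 hH
  have h2 : Hᴴ * G = Gᴴ * H := by
    calc Hᴴ * G = Hᴴ * (G * Hᴴ) * H := by
          rw [Matrix.mul_assoc, Matrix.mul_assoc, hH', Matrix.mul_one]
      _ = Gᴴ * H := by rw [h1, ← Matrix.mul_assoc, hH', Matrix.one_mul]
  intro i j
  have h3 := congrFun (congrFun h2 j) i
  rw [Matrix.mul_apply, Matrix.mul_apply, ← sub_eq_zero, ← Finset.sum_sub_distrib] at h3
  rw [← h3]
  refine Finset.sum_congr rfl fun k _ => ?_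
  simp only [G, Matrix.conjTranspose_apply, Matrix.transpose_apply, Matrix.of_apply, star_mul',
    Complex.star_def, Complex.conj_ofReal]
  ring

theorem Equivalent.exists_apply {H K : Matrix (Fin n) (Fin n) ℂ} (h : Equivalent H K) :
    ∃ (c d : Fin n → ℂ) (σ τ : Equiv.Perm (Fin n)), (∀ i, ‖c i‖ = 1) ∧ (∀ i, ‖d i‖ = 1) ∧
      ∀ i j, H i j = c i * K (σ i) (τ j) * d j := by
  obtain ⟨c, d, σ, τ, hc, hd, h⟩ := h
  refine ⟨c, d, σ, τ.symm, hc, hd, fun i j => ?_⟩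
  rw [h, Matrix.mul_diagonal, Matrix.mul_assoc (Matrix.diagonal c), Matrix.mul_assoc,
    Matrix.diagonal_mul, Equiv.Perm.permMatrix, Equiv.Perm.permMatrix,
    PEquiv.toMatrix_toPEquiv_mul, PEquiv.mul_toMatrix_toPEquiv]
  rfl

theorem equivalent_of_phases {H K : Matrix (Fin n) (Fin n) ℂ} (c d : Fin n → ℂ)
    (hc : ∀ i, ‖c i‖ = 1) (hd : ∀ i, ‖d i‖ = 1) (h : ∀ i j, H i j = c i * K i j * d j) :
    Equivalent H K := by
  refine ⟨c, d, 1, 1, hc, hd, ?_⟩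
  ext i j
  rw [Matrix.permMatrix_one, mul_one, mul_one, Matrix.mul_diagonal, Matrix.diagonal_mul, h]

theorem IsTangent.of_phases {H K : Matrix (Fin n) (Fin n) ℂ} {R : Matrix (Fin n) (Fin n) ℝ}
    (hR : IsTangent K R) {c d : Fin n → ℂ} {σ τ : Equiv.Perm (Fin n)} (hd : ∀ i, ‖d i‖ = 1)
    (h : ∀ i j, H i j = c i * K (σ i) (τ j) * d j) :
    IsTangent H (R.submatrix σ τ) := by
  intro i j
  rw [← mul_zero (c i * star (c j)), ← hR (σ i) (σ j), ← Equiv.sum_comp τ (fun k =>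
    K (σ i) k * star (K (σ j) k) * ((R (σ i) k : ℂ) - R (σ j) k)), Finset.mul_sum]
  refine Finset.sum_congr rfl fun k _ => ?_
  have hk : d k * star (d k) = 1 := by
    rw [Complex.star_def, Complex.mul_conj, Complex.normSq_eq_norm_sq, hd]; simp
  rw [h, h, star_mul', star_mul', Matrix.submatrix_apply, Matrix.submatrix_apply]
  linear_combination (c i * star (c j) * K (σ i) (τ k) * star (K (σ j) (τ k)) *
    ((R (σ i) (τ k) : ℂ) - R (σ j) (τ k))) * hk

theorem hasDerivAt_sum_exp (H : Matrix (Fin n) (Fin n) ℂ) (R : Matrix (Fin n) (Fin n) ℝ)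
    (i j : Fin n) :
    HasDerivAt (fun t : ℝ => ∑ k, H i k * star (H j k) *
      Complex.exp (Complex.I * ((t * R i k : ℝ) - (t * R j k : ℝ))))
      (Complex.I * ∑ k, H i k * star (H j k) * ((R i k : ℂ) - R j k)) 0 := by
  have h : HasDerivAt (fun t : ℝ => ∑ k, H i k * star (H j k) *
      Complex.exp (Complex.I * ((t * R i k : ℝ) - (t * R j k : ℝ))))
      (∑ k, H i k * star (H j k) *
        (Complex.exp (Complex.I * ((0 * R i k : ℝ) - (0 * R j k : ℝ))) *
        (Complex.I * ((1 * R i k : ℝ) - (1 * R j k : ℝ))))) 0 := by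
    refine HasDerivAt.fun_sum fun k _ => HasDerivAt.const_mul _ (HasDerivAt.cexp ?_)
    exact ((((hasDerivAt_id (0 : ℝ)).mul_const _).ofReal_comp).sub
      (((hasDerivAt_id (0 : ℝ)).mul_const _).ofReal_comp)).const_mul _
  convert h using 1
  rw [Finset.mul_sum]
  refine Finset.sum_congr rfl fun k _ => ?_
  simp only [zero_mul, Complex.ofReal_zero, sub_zero, mul_zero, Complex.exp_zero, one_mul]
  ring

theorem IsHadamard.sum_exp_of_twist {H : Matrix (Fin n) (Fin n) ℂ} {R : Matrix (Fin n) (Fin n) ℝ}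
    (h : IsHadamard (twist H R)) (i j : Fin n) :
    ∑ k, H i k * star (H j k) * Complex.exp (Complex.I * ((R i k : ℂ) - R j k)) =
      if i = j then 1 else 0 := by
  rw [← h.sum_mul_star i j]
  refine Finset.sum_congr rfl fun k _ => ?_
  simp only [twist, Matrix.of_apply, star_mul', Complex.star_def, ← Complex.exp_conj, map_mul,
    Complex.conj_I, Complex.conj_ofReal]
  rw [mul_mul_mul_comm, ← Complex.exp_add]
  congr 2
  ring

theorem isTangent_of_isHadamard_twist {H : Matrix (Fin n) (Fin n) ℂ}
    {R : Matrix (Fin n) (Fin n) ℝ} (h : ∀ t : ℝ, IsHadamard (twist H (t • R))) :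
    IsTangent H R := by
  intro i j
  have hderiv := hasDerivAt_sum_exp H R i j
  have hconst : (fun t : ℝ => ∑ k, H i k * star (H j k) *
      Complex.exp (Complex.I * ((t * R i k : ℝ) - (t * R j k : ℝ)))) =
      fun _ => if i = j then 1 else 0 :=
    funext fun t => (h t).sum_exp_of_twist i j
  rw [hconst] at hderiv
  exact (mul_eq_zero.1 (hderiv.unique (hasDerivAt_const (0 : ℝ) _))).resolve_left Complex.I_ne_zero

theorem twist_add (H : Matrix (Fin n) (Fin n) ℂ) (R R' : Matrix (Fin n) (Fin n) ℝ) :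
    twist H (R + R') = twist (twist H R) R' := by
  ext i j
  simp only [twist, Matrix.of_apply, Matrix.add_apply, Complex.ofReal_add, mul_add,
    Complex.exp_add, mul_assoc]

theorem twist_zero (H : Matrix (Fin n) (Fin n) ℂ) : twist H 0 = H := by
  ext i j
  simp [twist]

end Hadamard

/-! ### Rigidity of `S₁₄` -/

theorem isHadamard_S14 : IsHadamard S14 := by
  rw [← dephase_H14]
  exact isHadamard_dephase isHadamard_H14

theorem S14_tangent_equation {R : Matrix (Fin 14) (Fin 14) ℝ} (h : IsTangent S14 R)
    (p q : ZMod 7 ⊕ ZMod 7) :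
    ∑ k, ψ (blockExp p (.inl k) - blockExp q (.inl k)) *
        ((R (blockIdx p) (blockIdx (.inl k)) : ℂ) - R (blockIdx q) (blockIdx (.inl k))) +
      ∑ k, ψ (blockExp p (.inr k) - blockExp q (.inr k)) *
        ((R (blockIdx p) (blockIdx (.inr k)) : ℂ) - R (blockIdx q) (blockIdx (.inr k))) = 0 := by
  have h1 := h (blockIdx p) (blockIdx q)
  have h2 : ∀ k, S14 (blockIdx p) (blockIdx k) * star (S14 (blockIdx q) (blockIdx k)) =
      (14 : ℂ)⁻¹ * ψ (blockExp p k - blockExp q k) := fun k => by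
    rw [S14_blockIdx, S14_blockIdx, star_div₀, star_psi, Complex.star_def, Complex.conj_ofReal,
      div_mul_div_comm, sqrt_natCast_mul_self, ← AddChar.map_add_eq_mul, ← sub_eq_add_neg,
      div_eq_inv_mul, Nat.cast_ofNat]
  rw [← blockIdx.sum_comp] at h1
  simp only [h2, mul_assoc, ← Finset.mul_sum] at h1
  rw [Fintype.sum_sum_type] at h1
  exact (mul_eq_zero.1 h1).resolve_left (by norm_num)

theorem S14_tangent_equation_transpose {R : Matrix (Fin 14) (Fin 14) ℝ} (h : IsTangent S14 R)
    (p q : ZMod 7 ⊕ ZMod 7) :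
    ∑ k, ψ (blockExp (.inl k) p - blockExp (.inl k) q) *
        ((R (blockIdx (.inl k)) (blockIdx p) : ℂ) - R (blockIdx (.inl k)) (blockIdx q)) +
      ∑ k, ψ (blockExp (.inr k) p - blockExp (.inr k) q) *
        ((R (blockIdx (.inr k)) (blockIdx p) : ℂ) - R (blockIdx (.inr k)) (blockIdx q)) = 0 := by
  have h1 := h.transpose isHadamard_S14.1 (blockIdx p) (blockIdx q)
  have h2 : ∀ k, S14ᵀ (blockIdx p) (blockIdx k) * star (S14ᵀ (blockIdx q) (blockIdx k)) =
      (14 : ℂ)⁻¹ * ψ (blockExp k p - blockExp k q) := fun k => by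
    rw [Matrix.transpose_apply, Matrix.transpose_apply, S14_blockIdx, S14_blockIdx, star_div₀,
      star_psi, Complex.star_def, Complex.conj_ofReal,
      div_mul_div_comm, sqrt_natCast_mul_self, ← AddChar.map_add_eq_mul, ← sub_eq_add_neg,
      div_eq_inv_mul, Nat.cast_ofNat]
  rw [← blockIdx.sum_comp] at h1
  simp only [h2, mul_assoc, ← Finset.mul_sum] at h1
  simp only [Matrix.transpose_apply] at h1
  rw [Fintype.sum_sum_type] at h1
  exact (mul_eq_zero.1 h1).resolve_left (by norm_num)

/-- Infinitesimal deformations of `S₁₄` only change the phases of rows and columns. -/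
theorem S14_rigid {R : Matrix (Fin 14) (Fin 14) ℝ} (h : IsTangent S14 R) :
    ∃ r s : Fin 14 → ℝ, ∀ i j, R i j = r i + s j := by
  let Q : ZMod 7 ⊕ ZMod 7 → ZMod 7 ⊕ ZMod 7 → ℝ := fun p q => R (blockIdx p) (blockIdx q)
  -- `s` is the mean of a column over the upper rows, `r` the mean of a row over the left columns
  -- once `s` is removed. Subtracting them kills exactly the marginals required by
  -- `eq_zero_of_block_equations`.
  let s : ZMod 7 ⊕ ZMod 7 → ℝ := fun q => (∑ i, Q (.inl i) q) / 7
  let r : ZMod 7 ⊕ ZMod 7 → ℝ := fun p => (∑ m, (Q p (.inl m) - s (.inl m))) / 7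
  let s' : Fin 14 → ℝ := fun j => s (blockIdx.symm j)
  let r' : Fin 14 → ℝ := fun i => r (blockIdx.symm i)
  have hT : IsTangent S14 (R - Matrix.of fun i j => r' i + s' j) :=
    h.sub (isTangent_add isHadamard_S14 r' s')
  have hval : ∀ p q, (R - Matrix.of fun i j => r' i + s' j) (blockIdx p) (blockIdx q) =
      Q p q - (r p + s q) := fun p q => by
    simp only [Matrix.sub_apply, Matrix.of_apply, r', s', Equiv.symm_apply_apply, Q]
  have hrow := S14_tangent_equation hT
  have hcol := S14_tangent_equation_transpose hT
  simp only [hval] at hrow hcol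
  have hs : ∀ q, ∑ i, Q (.inl i) q = 7 * s q := fun q => by simp only [s]; ring
  have hr : ∀ p, ∑ m, (Q p (.inl m) - s (.inl m)) = 7 * r p := fun p => by simp only [r]; ring
  -- The upper values of `r` have mean zero, so subtracting `r` does not disturb the column
  -- marginals already cleared by `s`.
  have hrsum : ∑ i, r (.inl i) = 0 := by
    have : ∑ i, 7 * r (.inl i) = 0 := by
      simp only [← hr]
      rw [Finset.sum_comm]
      refine Finset.sum_eq_zero fun m _ => ?_
      rw [Finset.sum_sub_distrib, hs, Finset.sum_const, Finset.card_univ, ZMod.card, nsmul_eq_mul]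
      norm_num
    rw [← Finset.mul_sum] at this
    linarith
  have hrow0 : ∀ p, ∑ m, (Q p (.inl m) - (r p + s (.inl m))) = 0 := fun p => by
    have h1 : ∀ m, Q p (.inl m) - (r p + s (.inl m)) = (Q p (.inl m) - s (.inl m)) - r p :=
      fun m => by ring
    simp only [h1]
    rw [Finset.sum_sub_distrib, hr, Finset.sum_const, Finset.card_univ, ZMod.card, nsmul_eq_mul]
    norm_num
  have hcol0 : ∀ q, ∑ i, (Q (.inl i) q - (r (.inl i) + s q)) = 0 := fun q => by
    rw [Finset.sum_sub_distrib, Finset.sum_add_distrib, hs, hrsum, Finset.sum_const,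
      Finset.card_univ, ZMod.card, nsmul_eq_mul]
    norm_num
  have key := eq_zero_of_block_equations
    (a := fun i m => ((Q (.inl i) (.inl m) - (r (.inl i) + s (.inl m)) : ℝ) : ℂ))
    (b := fun i m => ((Q (.inl i) (.inr m) - (r (.inl i) + s (.inr m)) : ℝ) : ℂ))
    (c := fun i m => ((Q (.inr i) (.inl m) - (r (.inr i) + s (.inl m)) : ℝ) : ℂ))
    (d := fun i m => ((Q (.inr i) (.inr m) - (r (.inr i) + s (.inr m)) : ℝ) : ℂ))
    (fun i j => hrow (.inl i) (.inl j)) (fun i j => hrow (.inr i) (.inr j))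
    (fun i j => hrow (.inl i) (.inr j)) (fun m n => hcol (.inl m) (.inl n))
    (fun m n => hcol (.inr m) (.inr n))
    (fun i => by rw [← Complex.ofReal_sum, hrow0, Complex.ofReal_zero])
    (fun m => by rw [← Complex.ofReal_sum, hcol0, Complex.ofReal_zero])
    (fun m => by rw [← Complex.ofReal_sum, hcol0, Complex.ofReal_zero])
    (fun i => by rw [← Complex.ofReal_sum, hrow0, Complex.ofReal_zero])
  simp only [Complex.ofReal_eq_zero] at key
  refine ⟨r', s', fun i j => ?_⟩
  obtain ⟨p, rfl⟩ := blockIdx.surjective i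
  obtain ⟨q, rfl⟩ := blockIdx.surjective j
  have hz : Q p q - (r p + s q) = 0 := by
    rcases p with i | i <;> rcases q with m | m
    exacts [(key i m).1, (key i m).2.1, (key i m).2.2.1, (key i m).2.2.2]
  simp only [r', s', Equiv.symm_apply_apply]
  exact sub_eq_zero.1 hz

/-- The form r i + s j is restated as an identity on 2 × 2 minors, which survives permutations of
rows and columns. -/
theorem S14_rigid_of_equivalent {K : Matrix (Fin 14) (Fin 14) ℂ} (hK : Equivalent S14 K)
    {R : Matrix (Fin 14) (Fin 14) ℝ} (hR : IsTangent K R) (i j k l : Fin 14) :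
    R i j + R k l = R i l + R k j := by
  obtain ⟨c, d, σ, τ, _, hd, h⟩ := hK.exists_apply
  obtain ⟨r, s, hrs⟩ := S14_rigid (hR.of_phases hd h)
  obtain ⟨i, rfl⟩ := σ.surjective i
  obtain ⟨k, rfl⟩ := σ.surjective k
  obtain ⟨j, rfl⟩ := τ.surjective j
  obtain ⟨l, rfl⟩ := τ.surjective l
  simp only [Matrix.submatrix_apply] at hrs
  rw [hrs, hrs, hrs, hrs]
  ring

theorem tangentSpace_S14 : tangentSpace S14 = ⊥ := by
  rw [eq_bot_iff]
  rintro R ⟨⟨h0, h0'⟩, hR⟩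
  obtain ⟨r, s, hrs⟩ := S14_rigid hR
  rw [Submodule.mem_bot]
  ext i j
  have h1 := h0 0
  have h2 := h0 j
  have h3 := h0' i
  rw [hrs] at h1 h2 h3
  rw [hrs, Matrix.zero_apply]
  linarith

theorem defect_S14 : defect S14 = 0 := by
  rw [defect, tangentSpace_S14]
  exact finrank_bot ℝ _

theorem isButson_S14 : IsButson 14 7 S14 :=
  ⟨isHadamard_S14, fun i j => ⟨ω ^ expS14 i j, by
    rw [← pow_mul, mul_comm, pow_mul, isPrimitiveRoot_omega.pow_eq_one, one_pow], rfl⟩⟩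

/-! ### Isolation -/

theorem dephase_zero_left {n : ℕ} [NeZero n] {H : Matrix (Fin n) (Fin n) ℂ} (hH : IsHadamard H)
    (j : Fin n) : dephase H 0 j = 1 / (√(n : ℝ) : ℂ) := by
  rw [dephase, Matrix.of_apply, mul_comm,
    div_self (mul_ne_zero (hH.apply_ne_zero 0 0) (hH.apply_ne_zero 0 j))]

theorem dephase_zero_right {n : ℕ} [NeZero n] {H : Matrix (Fin n) (Fin n) ℂ} (hH : IsHadamard H)
    (i : Fin n) : dephase H i 0 = 1 / (√(n : ℝ) : ℂ) := by
  rw [dephase, Matrix.of_apply, div_self (mul_ne_zero (hH.apply_ne_zero i 0) (hH.apply_ne_zero 0 0))]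

theorem equivalent_dephase {n : ℕ} [NeZero n] {H : Matrix (Fin n) (Fin n) ℂ} (hH : IsHadamard H) :
    Equivalent H (dephase H) := by
  refine equivalent_of_phases (fun i => (√(n : ℝ) : ℂ) * H i 0) (fun j => H 0 j / H 0 0)
    (fun i => norm_sqrt_mul_apply hH _ _) (fun j => norm_apply_div_apply hH _ _ _ _) fun i j => ?_
  have := sqrt_natCast_ne_zero n
  have := hH.apply_ne_zero i 0
  have := hH.apply_ne_zero 0 j
  have := hH.apply_ne_zero 0 0
  rw [dephase, Matrix.of_apply]
  field_simp

theorem S14_zero_left (j : Fin 14) : S14 0 j = 1 / (√((14 : ℕ) : ℝ) : ℂ) := by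
  rw [← dephase_H14, dephase_zero_left isHadamard_H14]

theorem S14_zero_right (i : Fin 14) : S14 i 0 = 1 / (√((14 : ℕ) : ℝ) : ℂ) := by
  rw [← dephase_H14, dephase_zero_right isHadamard_H14]

theorem dephase_S14 : dephase S14 = S14 := by
  ext i j
  have := sqrt_natCast_ne_zero 14
  rw [dephase, Matrix.of_apply, S14_zero_left, S14_zero_left, S14_zero_right]
  field_simp

/-- The Gram matrix of the rows of `S₁₄ ∘ EXP(i R)`, together with the border of `R`. -/
noncomputable def gramBorder (R : Fin 14 → Fin 14 → ℝ) :
    (Fin 14 → Fin 14 → ℂ) × (Fin 14 → ℝ) × (Fin 14 → ℝ) :=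
  (fun i j => ∑ k, S14 i k * star (S14 j k) * Complex.exp (Complex.I * ((R i k : ℂ) - R j k)),
    fun j => R 0 j, fun i => R i 0)

theorem differentiable_gramBorder : Differentiable ℝ gramBorder := by
  unfold gramBorder
  have h : ∀ i k : Fin 14, Differentiable ℝ fun R : Fin 14 → Fin 14 → ℝ => (R i k : ℂ) :=
    fun i k => Complex.ofRealCLM.differentiable.comp (by fun_prop)
  refine Differentiable.prodMk (differentiable_pi.2 fun i => differentiable_pi.2 fun j => ?_)
    (by fun_prop)
  exact Differentiable.fun_sum fun k _ =>
    (Differentiable.cexp (((h i k).sub (h j k)).const_mul _)).const_mul _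

/-- The kernel of the derivative at 0 lies in `tangentSpace S14`, which is zero. An injective linear
map in finite dimension is bounded below, so the value at 0 is not taken again nearby. -/
theorem gramBorder_eventually_ne :
    ∀ᶠ R in nhds (0 : Fin 14 → Fin 14 → ℝ), gramBorder R = gramBorder 0 → R = 0 := by
  have hd := (differentiable_gramBorder 0).hasFDerivAt
  have hker : (fderiv ℝ gramBorder 0).toLinearMap.ker = ⊥ := by
    rw [LinearMap.ker_eq_bot']
    intro R hR
    have hline : HasDerivAt (fun t : ℝ => gramBorder (t • R)) (fderiv ℝ gramBorder 0 R) 0 := by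
      have h1 : HasDerivAt (fun t : ℝ => t • R) R 0 := by
        simpa using (hasDerivAt_id (0 : ℝ)).smul_const R
      have h2 : HasFDerivAt gramBorder (fderiv ℝ gramBorder 0) ((0 : ℝ) • R) := by
        rwa [zero_smul]
      exact h2.comp_hasDerivAt (0 : ℝ) h1
    have hR0 : fderiv ℝ gramBorder 0 R = 0 := hR
    rw [hR0] at hline
    have hfst := hasDerivAt_pi.1 hline.fst
    have hsnd := hline.snd
    have hT : Matrix.of R ∈ tangentSpace S14 := by
      refine ⟨⟨fun j => ?_, fun i => ?_⟩, fun i j => ?_⟩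
      · have h1 := hasDerivAt_pi.1 hsnd.fst j
        have h2 : HasDerivAt (fun t : ℝ => t * R 0 j) (1 * R 0 j) 0 :=
          (hasDerivAt_id (0 : ℝ)).mul_const _
        have h3 := h2.unique h1
        rw [one_mul] at h3
        exact h3
      · have h1 := hasDerivAt_pi.1 hsnd.snd i
        have h2 : HasDerivAt (fun t : ℝ => t * R i 0) (1 * R i 0) 0 :=
          (hasDerivAt_id (0 : ℝ)).mul_const _
        have h3 := h2.unique h1
        rw [one_mul] at h3
        exact h3
      · have h1 := hasDerivAt_pi.1 (hfst i) j
        have h2 := hasDerivAt_sum_exp S14 (Matrix.of R) i j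
        exact (mul_eq_zero.1 (h2.unique h1)).resolve_left Complex.I_ne_zero
    rw [tangentSpace_S14, Submodule.mem_bot] at hT
    exact hT
  obtain ⟨K, _, hK⟩ := LinearMap.exists_antilipschitzWith _ hker
  have h := hd.eventually_ne (c := gramBorder 0) ⟨K, hK⟩
  rw [eventually_nhdsWithin_iff] at h
  filter_upwards [h] with R hR hR0
  by_contra hne
  exact hR hne hR0

theorem S14_isolated : ∀ᶠ H in nhds S14, IsHadamard H → Equivalent H S14 := by
  -- Phases of the dephased matrix relative to `S14`; near `S14` the quotients are close to 1, where
  -- the argument is continuous.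
  let Φ : Matrix (Fin 14) (Fin 14) ℂ → Fin 14 → Fin 14 → ℝ :=
    fun H i j => Complex.arg (dephase H i j / S14 i j)
  have hne := isHadamard_S14.apply_ne_zero
  have hΦ0 : Φ S14 = 0 := by
    funext i j
    simp only [Φ, dephase_S14, div_self (hne i j), Complex.arg_one, Pi.zero_apply]
  have hΦ : ContinuousAt Φ S14 := by
    refine continuousAt_pi.2 fun i => continuousAt_pi.2 fun j => ?_
    refine ContinuousAt.comp (f := fun H : Matrix (Fin 14) (Fin 14) ℂ => dephase H i j / S14 i j)
      (Complex.continuousAt_arg ?_) ?_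
    · rw [dephase_S14, div_self (hne i j)]
      exact Complex.one_mem_slitPlane
    · have he : ∀ i j, ContinuousAt (fun H : Matrix (Fin 14) (Fin 14) ℂ => H i j) S14 :=
        fun i j => (continuous_id.matrix_elem i j).continuousAt
      exact ((((he i j).mul (he 0 0)).div ((he i 0).mul (he 0 j))
        (mul_ne_zero (hne _ _) (hne _ _))).div_const _).div_const _
  have hev := hΦ.eventually (by rw [hΦ0]; exact gramBorder_eventually_ne)
  filter_upwards [hev] with H hH hHad
  have hdH := isHadamard_dephase hHad
  have hexp : ∀ i j, Complex.exp (Complex.I * (Φ H i j : ℂ)) = dephase H i j / S14 i j := by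
    intro i j
    have hn : ‖dephase H i j / S14 i j‖ = 1 := by
      rw [norm_div, hdH.2, isHadamard_S14.2, div_self]
      rw [← isHadamard_S14.2 i j]
      exact norm_ne_zero_iff.2 (hne i j)
    have := Complex.norm_mul_exp_arg_mul_I (dephase H i j / S14 i j)
    rw [hn, Complex.ofReal_one, one_mul, mul_comm] at this
    exact this
  have htw : twist S14 (Matrix.of (Φ H)) = dephase H := by
    ext i j
    rw [twist, Matrix.of_apply, Matrix.of_apply, hexp, mul_div_cancel₀ _ (hne i j)]
  -- Both dephased matrices are unitary with the same border, so `gramBorder` takes the same value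
  -- at `Φ H` and at 0.
  have hzero : Φ H = 0 := by
    refine hH (Prod.ext ?_ (Prod.ext ?_ ?_))
    · funext i j
      have h1 := IsHadamard.sum_exp_of_twist (by rw [htw]; exact hdH) i j
      have h2 := IsHadamard.sum_exp_of_twist (by rw [twist_zero]; exact isHadamard_S14) i j
      exact h1.trans h2.symm
    · funext j
      show Complex.arg (dephase H 0 j / S14 0 j) = 0
      rw [dephase_zero_left hHad, ← S14_zero_left j, div_self (hne 0 j), Complex.arg_one]
    · funext i
      show Complex.arg (dephase H i 0 / S14 i 0) = 0
      rw [dephase_zero_right hHad, ← S14_zero_right i, div_self (hne i 0), Complex.arg_one]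
  have hS : dephase H = S14 := by
    rw [← htw, hzero]
    exact twist_zero S14
  rw [← hS]
  exact equivalent_dephase hHad

/-! ### Inequivalence -/

/-- At each member of the family, V itself consists of tangent directions; a direction with zero
border satisfying the minor identity of rigidity is zero. -/
theorem not_equivalent_of_affineFamily (H : Matrix (Fin 14) (Fin 14) ℂ)
    (V : Submodule ℝ (Matrix (Fin 14) (Fin 14) ℝ)) (hV : V ≠ ⊥) (hHV : IsAffineFamily H V)
    (R : Matrix (Fin 14) (Fin 14) ℝ) (hR : R ∈ V) : ¬ Equivalent S14 (twist H R) := by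
  intro h
  obtain ⟨R', hR', hne⟩ := V.ne_bot_iff.1 hV
  have hT : IsTangent (twist H R) R' := isTangent_of_isHadamard_twist fun t => by
    rw [← twist_add]
    exact hHV.2 _ (V.add_mem hR (V.smul_mem t hR'))
  obtain ⟨h0, h0'⟩ := hHV.1 hR'
  refine hne ?_
  ext i j
  have := S14_rigid_of_equivalent h hT i j 0 0
  rw [h0, h0', h0, add_zero, add_zero] at this
  exact this

theorem omega_pow_ne_one {r : ℕ} (hr : ¬ 7 ∣ r) : ω ^ r ≠ 1 :=
  fun h => hr (isPrimitiveRoot_omega.dvd_of_pow_eq_one r h)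

/-- The quotient H₁₁H₀₀ / (H₁₀H₀₁) is unchanged by rephasing. For `S14` it is ω, while for any four
such entries of a BH(14, r) matrix it is an r-th root of unity. -/
theorem not_equivalent_of_isButson (r : ℕ) (hr : ¬ 7 ∣ r) (L : Matrix (Fin 14) (Fin 14) ℂ)
    (hL : IsButson 14 r L) : ¬ Equivalent S14 L := by
  intro h
  obtain ⟨c, d, σ, τ, hc, hd, h⟩ := h.exists_apply
  choose ζ hζ hLζ using hL.2
  have hne := isHadamard_S14.apply_ne_zero
  have h14 := sqrt_natCast_ne_zero 14
  have hζ0 : ∀ i j, ζ i j ≠ 0 := fun i j h0 => by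
    have := hL.1.apply_ne_zero i j
    rw [hLζ, h0, zero_div] at this
    exact this rfl
  have hc0 : ∀ i, c i ≠ 0 := fun i => norm_ne_zero_iff.1 (by rw [hc]; exact one_ne_zero)
  have hd0 : ∀ i, d i ≠ 0 := fun i => norm_ne_zero_iff.1 (by rw [hd]; exact one_ne_zero)
  have hinv : S14 1 1 * S14 0 0 / (S14 1 0 * S14 0 1) =
      ζ (σ 1) (τ 1) * ζ (σ 0) (τ 0) / (ζ (σ 1) (τ 0) * ζ (σ 0) (τ 1)) := by
    rw [h, h, h, h, hLζ, hLζ, hLζ, hLζ]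
    have := hc0 0
    have := hc0 1
    have := hd0 0
    have := hd0 1
    have := hζ0 (σ 1) (τ 0)
    have := hζ0 (σ 0) (τ 1)
    field_simp
  have hω : S14 1 1 * S14 0 0 / (S14 1 0 * S14 0 1) = ω := by
    have h11 : S14 1 1 = ω ^ 1 / (√((14 : ℕ) : ℝ) : ℂ) := rfl
    rw [S14_zero_left, S14_zero_left, S14_zero_right, h11]
    field_simp
  refine omega_pow_ne_one hr ?_
  rw [← hω, hinv, div_pow, mul_pow, mul_pow, hζ, hζ, hζ, hζ]
  norm_num

theorem not_equivalent_of_conference (C : Matrix (Fin 14) (Fin 14) ℝ) (hC : IsSymmConference C)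
    (V : Submodule ℝ (Matrix (Fin 14) (Fin 14) ℝ)) (hV : IsAffineFamily (conferenceHadamard C) V)
    (R : Matrix (Fin 14) (Fin 14) ℝ) (hR : R ∈ V) :
    ¬ Equivalent S14 (twist (conferenceHadamard C) R) := by
  -- The zero space leaves only the dephased conference matrix, whose rescaled entries are fourth
  -- roots of unity; any other space falls under the affine family result.
  by_cases hbot : V = ⊥
  · subst hbot
    rw [(Submodule.mem_bot ℝ).1 hR]
    refine not_equivalent_of_isButson 4 (by norm_num) _ ⟨hV.2 _ (zero_mem _), fun i j => ?_⟩
    rw [twist_zero]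
    have hent : ∀ i j, ∃ ζ : ℂ, ζ ^ 4 = 1 ∧
        ((1 / (√((14 : ℕ) : ℝ) : ℂ)) • (1 + Complex.I • C.map Complex.ofReal)) i j =
          1 / (√((14 : ℕ) : ℝ) : ℂ) * ζ := by
      intro i j
      have hI : Complex.I ^ 4 = 1 := Complex.I_pow_four
      simp only [Matrix.smul_apply, Matrix.add_apply, Matrix.map_apply, smul_eq_mul]
      refine ⟨_, ?_, rfl⟩
      by_cases hij : i = j
      · subst hij
        rw [hC.2.1]
        simp
      · rw [Matrix.one_apply_ne hij]
        rcases hC.2.2.1 i j hij with h | h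
        · rw [h]; simp [hI]
        · rw [h]
          have : (-Complex.I) ^ 4 = 1 := by rw [neg_pow, hI]; norm_num
          simp [this]
    choose ζ hζ hent using hent
    refine ⟨ζ i j * ζ 0 0 / (ζ i 0 * ζ 0 j), ?_, ?_⟩
    · rw [div_pow, mul_pow, mul_pow, hζ, hζ, hζ, hζ]
      norm_num
    · rw [conferenceHadamard, dephase, Matrix.of_apply, hent, hent, hent, hent]
      have h14 : (1 / (√((14 : ℕ) : ℝ) : ℂ)) ≠ 0 := one_div_ne_zero (sqrt_natCast_ne_zero 14)
      congr 1
      generalize 1 / (√((14 : ℕ) : ℝ) : ℂ) = w at h14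
      rw [mul_mul_mul_comm, mul_mul_mul_comm w (ζ i 0), mul_div_mul_left _ _ (mul_ne_zero h14 h14)]
  · exact not_equivalent_of_affineFamily _ V hbot hV R hR

/-- Multiplying one row of a single `N j₀` by a phase preserves the Diţă structure; the derivative
`R` of this deformation is tangent, and k, v > 1 provide a minor on which it violates rigidity. -/
theorem not_equivalent_of_isDitaType (Q : Matrix (Fin 14) (Fin 14) ℂ) (hQ : IsDitaType Q) :
    ¬ Equivalent S14 Q := by
  intro h
  obtain ⟨k, v, hkv, M, N, hk, hv, hM, hN, rfl⟩ := hQ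
  let e : Fin k × Fin v ≃ Fin 14 := finProdFinEquiv.trans (finCongr hkv)
  let x₀ : Fin v := ⟨0, by omega⟩
  let x₁ : Fin v := ⟨1, hv⟩
  let j₀ : Fin k := ⟨0, by omega⟩
  let j₁ : Fin k := ⟨1, hk⟩
  let R : Matrix (Fin 14) (Fin 14) ℝ := Matrix.of fun i j =>
    if (e.symm i).2 = x₀ ∧ (e.symm j).1 = j₀ then 1 else 0
  have hRe : ∀ p q, R (e p) (e q) = if p.2 = x₀ ∧ q.1 = j₀ then 1 else 0 := fun p q => by
    simp only [R, Matrix.of_apply, Equiv.symm_apply_apply]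
  have hT : IsTangent (Matrix.reindex e e
      (Matrix.of fun (x y : Fin k × Fin v) => M x.1 y.1 * N y.1 x.2 y.2)) R := by
    intro i j
    obtain ⟨p, rfl⟩ := e.surjective i
    obtain ⟨q, rfl⟩ := e.surjective j
    rw [← e.sum_comp, Fintype.sum_prod_type]
    refine Finset.sum_eq_zero fun a _ => ?_
    have hterm : ∀ b, Matrix.reindex e e
        (Matrix.of fun (x y : Fin k × Fin v) => M x.1 y.1 * N y.1 x.2 y.2) (e p) (e (a, b)) *
        star (Matrix.reindex e e
        (Matrix.of fun (x y : Fin k × Fin v) => M x.1 y.1 * N y.1 x.2 y.2) (e q) (e (a, b))) *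
        ((R (e p) (e (a, b)) : ℂ) - R (e q) (e (a, b))) =
        M p.1 a * star (M q.1 a) * ((R (e p) (e (a, x₀)) : ℂ) - R (e q) (e (a, x₀))) *
          (N a p.2 b * star (N a q.2 b)) := fun b => by
      simp only [Matrix.reindex_apply, Matrix.submatrix_apply, Equiv.symm_apply_apply,
        Matrix.of_apply, hRe, star_mul']
      ring
    simp only [hterm]
    rw [← Finset.mul_sum, (hN a).sum_mul_star]
    split_ifs with hpq
    · rw [hRe, hRe, hpq, sub_self]
      ring
    · rw [mul_zero]
  have := S14_rigid_of_equivalent h hT (e (j₀, x₀)) (e (j₀, x₀)) (e (j₀, x₁)) (e (j₁, x₀))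
  have hx : x₁ ≠ x₀ := by simp [x₀, x₁]
  have hj : j₁ ≠ j₀ := by simp [j₀, j₁]
  simp only [hRe, hx, hj, true_and, and_true, and_self, if_true, if_false] at this
  norm_num at this

/-- A direction of the Fourier family. -/
def fourierDirection : Matrix (Fin 14) (Fin 14) ℝ :=
  Matrix.of fun i j => if (i : ℕ) % 2 = 1 ∧ (j : ℕ) % 7 = 1 then 1 else 0

theorem fourierFamily14_apply_eight (a : Fin 6 → ℝ) (i : Fin 14) :
    fourierFamily14 a i 8 = (-1) ^ (i : ℕ) * fourierFamily14 a i 1 := by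
  have h7 : Complex.exp (2 * Real.pi * Complex.I / ((14 : ℕ) : ℂ)) ^ 7 = -1 := by
    rw [← Complex.exp_nat_mul, ← Complex.exp_pi_mul_I]
    congr 1
    push_cast
    ring
  have h8 : Complex.exp (2 * Real.pi * Complex.I / ((14 : ℕ) : ℂ)) ^ ((i : ℕ) * 8) =
      (-1) ^ (i : ℕ) * Complex.exp (2 * Real.pi * Complex.I / ((14 : ℕ) : ℂ)) ^ ((i : ℕ) * 1) := by
    rw [← h7, ← pow_mul, ← pow_add]
    congr 1
    ring
  simp only [fourierFamily14, twist, fourier, Matrix.of_apply]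
  rw [show ((8 : Fin 14) : ℕ) = 8 from rfl, show ((1 : Fin 14) : ℕ) = 1 from rfl, h8,
    show Fin.ofNat 7 8 = Fin.ofNat 7 1 from rfl]
  ring

/-- The direction is supported on columns 1 and 8, which agree up to the sign (-1)^i. For rows of
equal parity the differences vanish; for opposite parity the two columns cancel. -/
theorem isTangent_fourierDirection (a : Fin 6 → ℝ) :
    IsTangent (fourierFamily14 a) fourierDirection := by
  intro i j
  have hval : ∀ i k : Fin 14, fourierDirection i k =
      (if (i : ℕ) % 2 = 1 then 1 else 0) * (if k = 1 ∨ k = 8 then 1 else 0) := by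
    intro i k
    have hk : (k : ℕ) % 7 = 1 ↔ k = 1 ∨ k = 8 := by revert k; decide
    simp only [fourierDirection, Matrix.of_apply, hk]
    split_ifs <;> simp_all
  rw [Finset.sum_eq_add (1 : Fin 14) 8 (by decide)]
  · rw [fourierFamily14_apply_eight, fourierFamily14_apply_eight]
    simp only [hval, true_or, or_true, if_true, mul_one]
    rcases Nat.mod_two_eq_zero_or_one i with hi | hi <;>
      rcases Nat.mod_two_eq_zero_or_one j with hj | hj
    all_goals
      simp only [hi, hj, zero_ne_one, if_true, if_false, sub_self, mul_zero, add_zero]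
    · rw [(Nat.even_iff.2 hi).neg_one_pow, (Nat.odd_iff.2 hj).neg_one_pow]
      simp
    · rw [(Nat.odd_iff.2 hi).neg_one_pow, (Nat.even_iff.2 hj).neg_one_pow]
      simp
  · intro k _ hk
    have : ¬ (k = 1 ∨ k = 8) := by tauto
    simp [hval, this]
  · simp
  · simp

theorem not_equivalent_fourierFamily14 (a : Fin 6 → ℝ) :
    ¬ Equivalent S14 (fourierFamily14 a) := fun h => by
  have := S14_rigid_of_equivalent h (isTangent_fourierDirection a) 1 1 0 0
  simp [fourierDirection] at this

theorem not_equivalent_fourierFamily14_transpose (a : Fin 6 → ℝ) :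
    ¬ Equivalent S14 (fourierFamily14 a)ᵀ := fun h => by
  obtain ⟨c, d, σ, τ, hc, _, h⟩ := h.exists_apply
  -- The equivalence is read on transposes, where the Fourier direction pulls back to `S14ᵀ`;
  -- unitarity then carries it to a tangent direction of `S14` itself.
  have hT : IsTangent S14ᵀ (fourierDirection.submatrix τ σ) :=
    (isTangent_fourierDirection a).of_phases (c := d) hc fun i j => by
      rw [Matrix.transpose_apply, h, Matrix.transpose_apply]
      ring
  have hU : S14ᵀ * (S14ᵀ)ᴴ = 1 := by
    change S14ᵀ * (S14ᴴ)ᵀ = 1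
    rw [← Matrix.transpose_mul, mul_eq_one_comm.1 isHadamard_S14.1, Matrix.transpose_one]
  obtain ⟨r, s, hrs⟩ := S14_rigid (hT.transpose hU)
  simp only [Matrix.transpose_apply, Matrix.submatrix_apply] at hrs
  have h11 := hrs (σ.symm 1) (τ.symm 1)
  have h10 := hrs (σ.symm 1) (τ.symm 0)
  have h01 := hrs (σ.symm 0) (τ.symm 1)
  have h00 := hrs (σ.symm 0) (τ.symm 0)
  simp only [Equiv.apply_symm_apply] at h11 h10 h01 h00
  have : fourierDirection 1 1 + fourierDirection 0 0 =
      fourierDirection 0 1 + fourierDirection 1 0 := by linarith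
  simp [fourierDirection] at this

end CHM

theorem mainTheorem4 :
    -- `I₇, F₇, H₁, …, H₆` is a complete set of MU bases, and `S₁₄` is the dephased form of the
    -- Hadamard matrix built from `K₁ = H₁`, `L₁ = H₂`
    CHM.IsCompleteMUSet CHM.bases7 ∧
    CHM.IsHadamard (CHM.H14 (CHM.H7 1) (CHM.H7 2)) ∧
    CHM.dephase (CHM.H14 (CHM.H7 1) (CHM.H7 2)) = CHM.S14 ∧
    CHM.IsButson 14 7 CHM.S14 ∧
    -- `S₁₄` is isolated: its defect vanishes, and all Hadamard matrices near it are equivalent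
    -- to it
    CHM.defect CHM.S14 = 0 ∧
    (∀ᶠ H in nhds CHM.S14, CHM.IsHadamard H → CHM.Equivalent H CHM.S14) ∧
    -- the Fourier family and its transpose
    (∀ a : Fin 6 → ℝ, ¬ CHM.Equivalent CHM.S14 (CHM.fourierFamily14 a)) ∧
    (∀ a : Fin 6 → ℝ, ¬ CHM.Equivalent CHM.S14 (CHM.fourierFamily14 a).transpose) ∧
    -- every affine family stemming from `D₁₄`, in particular `D₁₄⁽⁵⁾`
    (∀ C : Matrix (Fin 14) (Fin 14) ℝ, CHM.IsSymmConference C →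
      ∀ V : Submodule ℝ (Matrix (Fin 14) (Fin 14) ℝ),
        CHM.IsAffineFamily (CHM.conferenceHadamard C) V →
        ∀ R ∈ V, ¬ CHM.Equivalent CHM.S14 (CHM.twist (CHM.conferenceHadamard C) R)) ∧
    -- every `BH(14, r)` matrix with `7 ∤ r`, in particular (`r = 4`) all the `L₁₄X⁽⁰⁾`
    (∀ r : ℕ, ¬ 7 ∣ r → ∀ L : Matrix (Fin 14) (Fin 14) ℂ, CHM.IsButson 14 r L →
      ¬ CHM.Equivalent CHM.S14 L) ∧
    -- every Diţă-type matrix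
    (∀ Q : Matrix (Fin 14) (Fin 14) ℂ, CHM.IsDitaType Q → ¬ CHM.Equivalent CHM.S14 Q) ∧
    -- every member of every affine family of positive dimension
    (∀ (H : Matrix (Fin 14) (Fin 14) ℂ) (V : Submodule ℝ (Matrix (Fin 14) (Fin 14) ℝ)),
      V ≠ ⊥ → CHM.IsAffineFamily H V → ∀ R ∈ V, ¬ CHM.Equivalent CHM.S14 (CHM.twist H R)) :=
  ⟨CHM.isCompleteMUSet_bases7, CHM.isHadamard_H14, CHM.dephase_H14, CHM.isButson_S14,
    CHM.defect_S14, CHM.S14_isolated, CHM.not_equivalent_fourierFamily14,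
    CHM.not_equivalent_fourierFamily14_transpose, CHM.not_equivalent_of_conference,
    CHM.not_equivalent_of_isButson, CHM.not_equivalent_of_isDitaType,
    CHM.not_equivalent_of_affineFamily⟩
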